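/- Let $E$ and $F$ be (real) Banach lattices and let $T:E\to F$ be a bounded linear operator with adjoint $T':F'\to E'$; the norm duals carry the order $f\le g\iff f(x)\le g(x)$ for all $x\ge 0$, with which they are Banach lattices. Terminology. A sequence $(x_n)$ in a Banach lattice $G$ is *disjoint* if $|x_m|\wedge|x_n|=0$ for $m\ne n$, and *uaw-null* if $|x_n|\wedge u\to 0$ weakly for every $u\in G^+$. A nonempty bounded set $A\subset G$ is *L-weakly compact* if $\|x_n\|\to0$ for every disjoint sequence $(x_n)$ in the solid hull $\{y: |y|\le|x|\text{ for some }x\in A\}$. A bounded set $A\subset G'$ is an *almost (L)-set* if $\sup_{f\in A}|f(x_n)|\to0$ for every disjoint weakly null sequence $(x_n)$ in $G$. A bounded operator $S:G\to X$ into a Banach space is *almost Dunford–Pettis* if $\|Sx_n\|\to0$ for every disjoint weakly null sequence $(x_n)$ in $G$, and *M-weakly compact* if $\|Sx_n\|\to0$ for every norm bounded disjoint sequence $(x_n)$ in $G$. $G$ is *order continuous* if $\|x_\alpha\|\to0$ for every net $x_\alpha\downarrow0$ in $G$. (I) The following are equivalent: 1. $T'[-f,f]$ is an L-weakly compact subset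 of $E'$ for every $f\in(F')^+$. 2. $|T(x_n)|\to0$ weakly for every norm bounded uaw-null sequence $(x_n)$ of $E$. 3. $f_n(T(x_n))\to0$ for every order bounded sequence $(f_n)\subset F'$ and every norm bounded uaw-null sequence $(x_n)$ of $E$. 4. $T'(A)$ is an L-weakly compact subset of $E'$ for every nonempty almost (L)-set $A\subset F'$. 5. For every Banach space $X$ and every almost Dunford–Pettis operator $S:F\to X$, the operator $S\circ T:E\to X$ is M-weakly compact. (II) The following are equivalent: 1. $E'$ is order continuous. 2. $|x_n|\to0$ weakly for every norm bounded uaw-null sequence $(x_n)$ of $E$. 3. $f_n(x_n)\to0$ for every order bounded sequence $(f_n)\subset E'$ and every norm bounded uaw-null sequence $(x_n)$ of $E$. 4. Every nonempty almost (L)-set $A\subset E'$ is L-weakly compact. 5. Every almost Dunford–Pettis operator $S:E\to X$ into an arbitrary Banach space $X$ is M-weakly compact. -/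

import Mathlib

open Set Filter Topology

universe u v w

noncomputable section

/-! ### The norm dual of a Banach lattice as a Banach lattice -/

namespace DualLattice

variable {E : Type*} [NormedAddCommGroup E] [NormedSpace ℝ E] [Lattice E] [HasSolidNorm E]
  [IsOrderedAddMonoid E]

set_option linter.unusedSectionVars false

/-- For `0 ≤ x` this is the Riesz--Kantorovich supremum `sup {f y : 0 ≤ y ≤ x}`. -/
def posSup (f : StrongDual ℝ E) (x : E) : ℝ := sSup (f '' Icc 0 x)

lemma norm_le_of_mem {x y : E} (hy : y ∈ Icc 0 x) : ‖y‖ ≤ ‖x‖ := by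
  apply norm_le_norm_of_abs_le_abs
  rw [abs_of_nonneg hy.1, abs_of_nonneg (hy.1.trans hy.2)]
  exact hy.2

lemma apply_le (f : StrongDual ℝ E) {x y : E} (hy : y ∈ Icc 0 x) : f y ≤ ‖f‖ * ‖x‖ :=
  (le_abs_self _).trans ((f.le_opNorm y).trans (by gcongr; exact norm_le_of_mem hy))

lemma bddAbove_image (f : StrongDual ℝ E) (x : E) : BddAbove (f '' Icc 0 x) := by
  refine ⟨‖f‖ * ‖x‖, ?_⟩
  rintro _ ⟨y, hy, rfl⟩
  exact apply_le f hy

lemma le_posSup (f : StrongDual ℝ E) {x y : E} (hy : y ∈ Icc 0 x) : f y ≤ posSup f x :=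
  le_csSup (bddAbove_image f x) ⟨y, hy, rfl⟩

lemma posSup_le (f : StrongDual ℝ E) {x : E} (hx : 0 ≤ x) {c : ℝ}
    (h : ∀ y ∈ Icc 0 x, f y ≤ c) : posSup f x ≤ c := by
  refine csSup_le ⟨f 0, 0, ⟨le_rfl, hx⟩, rfl⟩ ?_
  rintro _ ⟨y, hy, rfl⟩
  exact h y hy

lemma posSup_add (f : StrongDual ℝ E) {a b : E} (ha : 0 ≤ a) (hb : 0 ≤ b) :
    posSup f (a + b) = posSup f a + posSup f b := by
  apply le_antisymm
  · refine posSup_le f (add_nonneg ha hb) fun y hy => ?_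
    have h1 : y ⊓ a ∈ Icc 0 a := ⟨le_inf hy.1 ha, inf_le_right⟩
    have h2 : y - y ⊓ a ∈ Icc 0 b := by
      refine ⟨sub_nonneg.2 inf_le_left, ?_⟩
      rw [sub_le_iff_le_add', inf_add]
      exact le_inf (le_add_of_nonneg_right hb) hy.2
    have := add_le_add (le_posSup f h1) (le_posSup f h2)
    rwa [← map_add, add_sub_cancel] at this
  · rw [← le_sub_iff_add_le]
    refine posSup_le f ha fun y hy => ?_
    rw [le_sub_comm]
    refine posSup_le f hb fun z hz => ?_
    rw [le_sub_iff_add_le', ← map_add]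
    exact le_posSup f ⟨add_nonneg hy.1 hz.1, add_le_add hy.2 hz.2⟩

lemma posSup_sub (f : StrongDual ℝ E) {a b c d : E} (ha : 0 ≤ a) (hb : 0 ≤ b) (hc : 0 ≤ c)
    (hd : 0 ≤ d) (h : a - b = c - d) :
    posSup f a - posSup f b = posSup f c - posSup f d := by
  have h' : a + d = c + b := by
    rw [sub_eq_sub_iff_add_eq_add] at h
    exact h
  have := congrArg (posSup f) h'
  rw [posSup_add f ha hd, posSup_add f hc hb] at this
  linarith

lemma abs_posSup_le (f : StrongDual ℝ E) {x : E} (hx : 0 ≤ x) : |posSup f x| ≤ ‖f‖ * ‖x‖ := by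
  have h0 : (0 : ℝ) ≤ posSup f x := by
    have := le_posSup f (x := x) (y := 0) ⟨le_rfl, hx⟩
    rwa [map_zero] at this
  rw [abs_of_nonneg h0]
  exact posSup_le f hx fun y hy => apply_le f hy

/-- The additive extension to `E` of `x ↦ sup {f y : 0 ≤ y ≤ x}`. -/
def posAddHom (f : StrongDual ℝ E) : E →+ ℝ :=
  AddMonoidHom.mk' (fun x => posSup f x⁺ - posSup f x⁻) fun x y => by
    have h : (x + y)⁺ - (x + y)⁻ = (x⁺ + y⁺) - (x⁻ + y⁻) := by
      rw [posPart_sub_negPart, add_sub_add_comm, posPart_sub_negPart, posPart_sub_negPart]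
    rw [posSup_sub f (posPart_nonneg _) (negPart_nonneg _)
      (add_nonneg (posPart_nonneg x) (posPart_nonneg y))
      (add_nonneg (negPart_nonneg x) (negPart_nonneg y)) h,
      posSup_add f (posPart_nonneg x) (posPart_nonneg y),
      posSup_add f (negPart_nonneg x) (negPart_nonneg y)]
    ring

lemma continuous_posAddHom (f : StrongDual ℝ E) : Continuous (posAddHom f) := by
  refine AddMonoidHomClass.continuous_of_bound (posAddHom f) (‖f‖ + ‖f‖) fun x => ?_
  have h1 : ‖x⁺‖ ≤ ‖x‖ := by
    apply norm_le_norm_of_abs_le_abs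
    rw [abs_of_nonneg (posPart_nonneg x), ← posPart_add_negPart x]
    exact le_add_of_nonneg_right (negPart_nonneg x)
  have h2 : ‖x⁻‖ ≤ ‖x‖ := by
    apply norm_le_norm_of_abs_le_abs
    rw [abs_of_nonneg (negPart_nonneg x), ← posPart_add_negPart x]
    exact le_add_of_nonneg_left (posPart_nonneg x)
  calc ‖posSup f x⁺ - posSup f x⁻‖ ≤ |posSup f x⁺| + |posSup f x⁻| := abs_sub _ _
    _ ≤ ‖f‖ * ‖x⁺‖ + ‖f‖ * ‖x⁻‖ :=
      add_le_add (abs_posSup_le f (posPart_nonneg x)) (abs_posSup_le f (negPart_nonneg x))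
    _ ≤ ‖f‖ * ‖x‖ + ‖f‖ * ‖x‖ := by gcongr
    _ = (‖f‖ + ‖f‖) * ‖x‖ := by ring

/-- The positive part of a continuous functional. -/
def pos (f : StrongDual ℝ E) : StrongDual ℝ E :=
  (posAddHom f).toRealLinearMap (continuous_posAddHom f)

lemma pos_apply (f : StrongDual ℝ E) {x : E} (hx : 0 ≤ x) : pos f x = sSup (f '' Icc 0 x) := by
  change posSup f x⁺ - posSup f x⁻ = posSup f x
  rw [posPart_of_nonneg hx, negPart_of_nonneg hx]
  have : posSup f (0 : E) = 0 := by
    have := posSup_add f (le_refl (0 : E)) (le_refl 0)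
    rw [add_zero] at this
    linarith
  rw [this, sub_zero]

/-- The order of the dual: `f ≤ g` if and only if `f x ≤ g x` for all `x ≥ 0`. -/
instance instPartialOrder : PartialOrder (StrongDual ℝ E) where
  le f g := ∀ x : E, 0 ≤ x → f x ≤ g x
  le_refl f x _ := le_rfl
  le_trans f g h hfg hgh x hx := (hfg x hx).trans (hgh x hx)
  le_antisymm f g hfg hgf := by
    ext x
    rw [← posPart_sub_negPart x, map_sub, map_sub,
      le_antisymm (hfg _ (posPart_nonneg x)) (hgf _ (posPart_nonneg x)),
      le_antisymm (hfg _ (negPart_nonneg x)) (hgf _ (negPart_nonneg x))]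

lemma le_def {f g : StrongDual ℝ E} : f ≤ g ↔ ∀ x : E, 0 ≤ x → f x ≤ g x := Iff.rfl

instance instIsOrderedAddMonoid : IsOrderedAddMonoid (StrongDual ℝ E) where
  add_le_add_left f g h k x hx := by
    simpa using h x hx

lemma le_pos (f : StrongDual ℝ E) : f ≤ pos f := fun x hx => by
  rw [pos_apply f hx]
  exact le_posSup f ⟨hx, le_rfl⟩

lemma pos_nonneg (f : StrongDual ℝ E) : 0 ≤ pos f := fun x hx => by
  rw [pos_apply f hx]
  have := le_posSup f (x := x) (y := 0) ⟨le_rfl, hx⟩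
  rwa [map_zero] at this

lemma pos_le {f g : StrongDual ℝ E} (hfg : f ≤ g) (hg : 0 ≤ g) : pos f ≤ g := fun x hx => by
  rw [pos_apply f hx]
  refine posSup_le f hx fun y hy => (hfg y hy.1).trans ?_
  have := hg (x - y) (sub_nonneg.2 hy.2)
  rw [map_sub] at this
  simpa using this

/-- The norm dual of a Banach lattice is a lattice: `f ⊔ g = g + (f - g)⁺`. -/
instance instLattice : Lattice (StrongDual ℝ E) where
  sup f g := g + pos (f - g)
  inf f g := f - pos (f - g)
  le_sup_left f g := by
    have := le_pos (f - g)
    rwa [sub_le_iff_le_add'] at this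
  le_sup_right f g := le_add_of_nonneg_right (pos_nonneg _)
  sup_le f g h hf hg := by
    rw [← le_sub_iff_add_le']
    exact pos_le (sub_le_sub_right hf g) (sub_nonneg.2 hg)
  inf_le_left f g := sub_le_self f (pos_nonneg _)
  inf_le_right f g := by
    have := le_pos (f - g)
    rwa [sub_le_comm] at this
  le_inf f g h hf hg := by
    rw [le_sub_comm]
    refine pos_le ?_ (sub_nonneg.2 hf)
    exact sub_le_sub_left hg g

lemma abs_apply_le (f : StrongDual ℝ E) (x : E) : |f x| ≤ |f| |x| := by
  have h : ∀ g : StrongDual ℝ E, 0 ≤ g → |g x| ≤ g |x| := fun g hg => by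
    have h1 := hg (|x| - x) (sub_nonneg.2 (le_abs_self x))
    have h2 := hg (|x| + x) (by rw [← neg_le_iff_add_nonneg]; exact neg_le_abs x)
    simp only [map_sub, map_add, zero_apply] at h1 h2
    exact abs_le.2 ⟨by linarith, by linarith⟩
  have h1 := h _ (posPart_nonneg f)
  have h2 := h _ (negPart_nonneg f)
  calc |f x| = |f⁺ x - f⁻ x| := by
        rw [← sub_apply, posPart_sub_negPart]
    _ ≤ |f⁺ x| + |f⁻ x| := abs_sub _ _
    _ ≤ f⁺ |x| + f⁻ |x| := add_le_add h1 h2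
    _ = |f| |x| := by rw [← add_apply, posPart_add_negPart]

lemma abs_apply_le_norm (f : StrongDual ℝ E) {x : E} (hx : 0 ≤ x) : |f| x ≤ ‖f‖ * ‖x‖ := by
  have hf : |f| = pos (f - (-f)) + (-f) := by
    rw [add_comm]
    rfl
  rw [hf, add_apply, pos_apply _ hx, ← le_sub_iff_add_le]
  refine posSup_le _ hx fun y hy => ?_
  have hn : ‖y + y - x‖ ≤ ‖x‖ := by
    apply norm_le_norm_of_abs_le_abs
    rw [abs_of_nonneg hx, abs_le']
    constructor
    · rw [sub_le_iff_le_add]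
      exact add_le_add hy.2 hy.2
    · rw [neg_sub]
      exact sub_le_self x (add_nonneg hy.1 hy.1)
  have := (le_abs_self _).trans ((f.le_opNorm (y + y - x)).trans
    (mul_le_mul_of_nonneg_left hn (norm_nonneg f)))
  simp only [map_sub, map_add] at this
  simp only [sub_apply, neg_apply]
  linarith

/-- The dual norm is a lattice norm. -/
instance instHasSolidNorm : HasSolidNorm (StrongDual ℝ E) where
  solid f g h := by
    refine f.opNorm_le_bound (norm_nonneg g) fun x => ?_
    calc ‖f x‖ ≤ |f| |x| := abs_apply_le f x
      _ ≤ |g| |x| := h _ (abs_nonneg x)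
      _ ≤ ‖g‖ * ‖|x|‖ := abs_apply_le_norm g (abs_nonneg x)
      _ = ‖g‖ * ‖x‖ := by rw [norm_abs_eq_norm]

instance instIsOrderedModule : IsOrderedModule ℝ (StrongDual ℝ E) where
  smul_le_smul_of_nonneg_left c hc f g h x hx := mul_le_mul_of_nonneg_left (h x hx) hc
  smul_le_smul_of_nonneg_right f hf c d h x hx :=
    mul_le_mul_of_nonneg_right h (by simpa using hf x hx)

end DualLattice

/-! ### Sequences -/

/-- `x n → 0` weakly. -/
def WeaklyNull {X : Type*} [NormedAddCommGroup X] [NormedSpace ℝ X] (x : ℕ → X) : Prop :=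
  ∀ φ : StrongDual ℝ X, Tendsto (fun n => φ (x n)) atTop (𝓝 0)

/-- The sequence `x` is unbounded absolutely weakly convergent to `0`:
`|x n| ⊓ u → 0` weakly for every `u ≥ 0`. -/
def UawNull {E : Type*} [NormedAddCommGroup E] [NormedSpace ℝ E] [Lattice E] (x : ℕ → E) :
    Prop :=
  ∀ u : E, 0 ≤ u → WeaklyNull fun n => |x n| ⊓ u

/-- The terms of the sequence are pairwise disjoint. -/
def DisjointSeq {E : Type*} [AddGroup E] [Lattice E] (x : ℕ → E) : Prop :=
  ∀ m n : ℕ, m ≠ n → |x m| ⊓ |x n| = 0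

/-- The sequence is norm bounded. -/
def NormBoundedSeq {X : Type*} [NormedAddCommGroup X] (x : ℕ → X) : Prop :=
  ∃ C : ℝ, ∀ n, ‖x n‖ ≤ C

/-- The sequence is order bounded, i.e. it lies in an order interval. -/
def OrderBoundedSeq {E : Type*} [Preorder E] (x : ℕ → E) : Prop :=
  ∃ a b : E, ∀ n, x n ∈ Icc a b

/-! ### Sets -/

/-- Nonempty bounded sets `A` such that every disjoint sequence in the solid hull
`{y | ∃ x ∈ A, |y| ≤ |x|}` of `A` converges to `0` in norm. -/
def IsLWeaklyCompact {E : Type*} [NormedAddCommGroup E] [Lattice E] (A : Set E) : Prop :=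
  A.Nonempty ∧ Bornology.IsBounded A ∧
    ∀ x : ℕ → E, (∀ n, x n ∈ LatticeOrderedAddCommGroup.solidClosure A) → DisjointSeq x →
      Tendsto (fun n => ‖x n‖) atTop (𝓝 0)

/-- Bounded sets `A` of functionals with `sup_{f ∈ A} |f (x n)| → 0` for every disjoint weakly
null sequence `x`. (As `A` is bounded, the supremum is one of a bounded set of reals; it is `0`
if `A` is empty.) -/
def IsAlmostLSet {E : Type*} [NormedAddCommGroup E] [NormedSpace ℝ E] [Lattice E]
    (A : Set (StrongDual ℝ E)) : Prop :=
  Bornology.IsBounded A ∧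
    ∀ x : ℕ → E, DisjointSeq x → WeaklyNull x →
      Tendsto (fun n => ⨆ f : A, |f.1 (x n)|) atTop (𝓝 0)

/-! ### Operators -/

/-- The adjoint `T' f = f ∘ T`, as a map between the dual spaces. -/
def adjointMap {X Y : Type*} [NormedAddCommGroup X] [NormedSpace ℝ X] [NormedAddCommGroup Y]
    [NormedSpace ℝ Y] (T : X →L[ℝ] Y) (f : StrongDual ℝ Y) : StrongDual ℝ X :=
  f.comp T

/-- `‖T (x n)‖ → 0` for every norm bounded disjoint sequence `x`. -/
def IsMWeaklyCompact {E Y : Type*} [NormedAddCommGroup E] [NormedSpace ℝ E] [Lattice E]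
    [NormedAddCommGroup Y] [NormedSpace ℝ Y] (T : E →L[ℝ] Y) : Prop :=
  ∀ x : ℕ → E, DisjointSeq x → NormBoundedSeq x → Tendsto (fun n => ‖T (x n)‖) atTop (𝓝 0)

/-- `‖T (x n)‖ → 0` for every disjoint weakly null sequence `x`. -/
def IsAlmostDunfordPettis {E Y : Type*} [NormedAddCommGroup E] [NormedSpace ℝ E] [Lattice E]
    [NormedAddCommGroup Y] [NormedSpace ℝ Y] (T : E →L[ℝ] Y) : Prop :=
  ∀ x : ℕ → E, DisjointSeq x → WeaklyNull x → Tendsto (fun n => ‖T (x n)‖) atTop (𝓝 0)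

/-! ### Order continuity -/

/-- The norm is order continuous: every net decreasing to `0` converges to `0` in norm.
(A decreasing net may be replaced by the set of its values, directed downwards, so index sets
in the universe of `E` are enough.) -/
def IsOrderContinuous (E : Type u) [NormedAddCommGroup E] [Lattice E] : Prop :=
  ∀ (ι : Type u) [Preorder ι] [IsDirectedOrder ι] [Nonempty ι] (x : ι → E),
    Antitone x → IsGLB (range x) 0 → Tendsto (fun i => ‖x i‖) atTop (𝓝 0)

end

set_option linter.unusedSectionVars false

noncomputable section

namespace BanachLattice


/-! ### Vector lattices -/

section LatticeGroup

variable {G : Type*} [AddCommGroup G] [Lattice G] [IsOrderedAddMonoid G]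

/-! Smallness along disjoint sequences is upgraded to smallness up to an order interval, once in the
lattice and once in its dual. In the lattice, if a bounded set of functionals vanishes uniformly
along the disjoint sequences of a bounded, downward closed set `B` of positive elements, then `B`
lies in some `[0, u]` up to a uniformly small error (`exists_forall_posPart_sub_le`). The same
theorem in the dual, with evaluation at `u` as the test function, puts the functionals into an order
interval up to `ε` at `u` (`exists_forall_posPart_sub_apply_le`). Its hypothesis comes from
`tendsto_apply_zero_of_disjoint`: disjoint functionals that stay large at `w` yield disjoint
elements of `[0, w]` on which they stay large. Cutting both the elements and the functionals gives
`tendsto_abs_apply_of_inf_weaklyNull`.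

Hence a nonempty bounded set of functionals is L-weakly compact exactly when it vanishes uniformly
along norm bounded disjoint sequences, and it then does so along norm bounded uaw-null sequences.
Likewise almost (L)-sets vanish uniformly along norm bounded positive weakly null sequences,
disjoint or not. Part (I) follows by the cycle 1 → 3 → 2 → 4 → 1 and by 4 ↔ 5, where the adjoint
image of the dual ball turns operators into almost (L)-sets, and an operator into `ℓ^∞` built from a
sequence of functionals goes back. Part (II) is the case of the identity, because the dual norm is
order continuous exactly when all intervals `[-f, f]` are L-weakly compact. -/

lemma inf_eq_zero_of_le {a b a' b' : G} (ha : 0 ≤ a) (hb : 0 ≤ b) (haa : a ≤ a') (hbb : b ≤ b')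
    (h : a' ⊓ b' = 0) : a ⊓ b = 0 :=
  le_antisymm ((inf_le_inf haa hbb).trans h.le) (le_inf ha hb)

lemma posPart_sub_inf_posPart_sub (a b : G) : (a - b)⁺ ⊓ (b - a)⁺ = 0 := by
  have h := posPart_inf_negPart_eq_zero (a - b)
  rwa [← posPart_neg, neg_sub] at h

lemma posPart_le {a b : G} (h : a ≤ b) (hb : 0 ≤ b) : a⁺ ≤ b := sup_le h hb

lemma posPart_sub_le {a b : G} (ha : 0 ≤ a) (hb : 0 ≤ b) : (a - b)⁺ ≤ a :=
  posPart_le (sub_le_self a hb) ha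

lemma inf_add_posPart_sub (a b : G) : a ⊓ b + (a - b)⁺ = a := by
  rw [inf_eq_sub_posPart_sub, sub_add_cancel]

lemma disjointSeq_of_lt {x : ℕ → G} (hx : ∀ n, 0 ≤ x n) (h : ∀ m n, m < n → x m ⊓ x n = 0) :
    DisjointSeq x := by
  intro m n hmn
  rw [abs_of_nonneg (hx m), abs_of_nonneg (hx n)]
  rcases lt_or_gt_of_ne hmn with hl | hl
  · exact h m n hl
  · rw [inf_comm]
    exact h n m hl

lemma _root_.DisjointSeq.of_le {x y : ℕ → G} (hx : DisjointSeq x) (h : ∀ n, |y n| ≤ |x n|) :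
    DisjointSeq y := fun m n hmn =>
  inf_eq_zero_of_le (abs_nonneg _) (abs_nonneg _) (h m) (h n) (hx m n hmn)

lemma add_inf_eq_zero {a b c : G} (ha : 0 ≤ a) (hb : 0 ≤ b) (hc : 0 ≤ c) (hac : a ⊓ c = 0)
    (hbc : b ⊓ c = 0) : (a + b) ⊓ c = 0 := by
  refine le_antisymm ?_ (le_inf (add_nonneg ha hb) hc)
  have h1 : (a + b) ⊓ c - a ⊓ c ≤ b := by
    rw [sub_le_iff_le_add', inf_add]
    exact le_inf inf_le_left (inf_le_right.trans (le_add_of_nonneg_right hb))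
  rw [hac, sub_zero] at h1
  exact (le_inf h1 inf_le_right).trans hbc.le

lemma sum_inf_eq_zero {ι : Type*} {x : ι → G} (hx : ∀ i, 0 ≤ x i) {c : G} (hc : 0 ≤ c)
    (s : Finset ι) (h : ∀ i ∈ s, x i ⊓ c = 0) : (∑ i ∈ s, x i) ⊓ c = 0 := by
  classical
  induction s using Finset.induction_on with
  | empty => simpa using hc
  | insert a s ha ih =>
    rw [Finset.sum_insert ha]
    exact add_inf_eq_zero (hx a) (Finset.sum_nonneg fun i _ => hx i) hc
      (h a (Finset.mem_insert_self a s)) (ih fun i hi => h i (Finset.mem_insert_of_mem hi))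

/-- Since `a + b = a ⊓ b + a ⊔ b`, a sum of disjoint elements is their supremum. -/
lemma sum_le_of_pairwise_inf {ι : Type*} {x : ι → G} (hx : ∀ i, 0 ≤ x i) {u : G} (hu : 0 ≤ u)
    (hxu : ∀ i, x i ≤ u) (s : Finset ι) (h : ∀ i j, i ≠ j → x i ⊓ x j = 0) :
    ∑ i ∈ s, x i ≤ u := by
  classical
  induction s using Finset.induction_on with
  | empty => simpa using hu
  | insert a s ha ih =>
    have h0 : (∑ i ∈ s, x i) ⊓ x a = 0 :=
      sum_inf_eq_zero hx (hx a) s fun i hi => h i a (ne_of_mem_of_not_mem hi ha)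
    rw [Finset.sum_insert ha, add_comm, ← inf_add_sup, h0, zero_add]
    exact sup_le ih (hxu a)

lemma _root_.DisjointSeq.inf_of_nonneg {x : ℕ → G} (hx : DisjointSeq x) (h0 : ∀ n, 0 ≤ x n) {m n : ℕ}
    (h : m ≠ n) : x m ⊓ x n = 0 := by
  have := hx m n h
  rwa [abs_of_nonneg (h0 m), abs_of_nonneg (h0 n)] at this

lemma abs_le_abs_sub_posPart (h g : G) : |h| ≤ g + (|h| - g)⁺ := by
  rw [← sub_le_iff_le_add']
  exact le_posPart _

variable [Module ℝ G] [IsOrderedModule ℝ G]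

lemma smul_posPart_le {c : ℝ} (hc : 0 < c) {a b : G} (h : c • a ≤ b) : c • a⁺ ≤ b⁺ := by
  rw [← le_inv_smul_iff_of_pos hc] at h ⊢
  exact posPart_le (h.trans (smul_le_smul_of_nonneg_left (le_posPart b) (inv_nonneg.2 hc.le)))
    (smul_nonneg (inv_nonneg.2 hc.le) (posPart_nonneg b))

lemma inf_eq_zero_of_smul {c : ℝ} (hc : 1 ≤ c) {a b a' b' : G} (ha : 0 ≤ a) (hb : 0 ≤ b)
    (haa : c • a ≤ a') (hbb : b ≤ b') (h : a' ⊓ b' = 0) : a ⊓ b = 0 := by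
  refine inf_eq_zero_of_le ha hb (le_trans ?_ haa) hbb h
  have := smul_le_smul_of_nonneg_right hc ha
  rwa [one_smul] at this

end LatticeGroup

/-! ### Norm estimates for positive parts -/

section NormedLattice

variable {G : Type*} [NormedAddCommGroup G] [Lattice G] [IsOrderedAddMonoid G] [HasSolidNorm G]

lemma norm_le_norm_of_nonneg {a b : G} (ha : 0 ≤ a) (h : a ≤ b) : ‖a‖ ≤ ‖b‖ := by
  apply norm_le_norm_of_abs_le_abs
  rwa [abs_of_nonneg ha, abs_of_nonneg (ha.trans h)]

lemma norm_posPart_sub_posPart_le (a b : G) : ‖a⁺ - b⁺‖ ≤ ‖a - b‖ := by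
  simpa [dist_eq_norm] using (lipschitzWith_posPart (α := G)).dist_le_mul a b

lemma norm_posPart_le (a : G) : ‖a⁺‖ ≤ ‖a‖ := by
  simpa using norm_posPart_sub_posPart_le a 0

end NormedLattice

/-! ### The disjoint sequence theorem -/

section DisjointSequence

variable {G : Type*} [NormedAddCommGroup G] [NormedSpace ℝ G] [CompleteSpace G] [Lattice G]
  [IsOrderedAddMonoid G] [IsOrderedModule ℝ G] [HasSolidNorm G]

/-- The partial sums of the sequence `x n = X (4 ^ n • ∑ i < n, x i)`. -/
def recSum (X : G → G) : ℕ → G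
  | 0 => 0
  | n + 1 => recSum X n + X ((4 : ℝ) ^ n • recSum X n)

/-- If a uniformly Lipschitz family of functions tends to zero along the disjoint sequences of a
bounded set `B` of positive elements that is downward closed, then it is uniformly small on the
elements `(x - u)⁺`, `x ∈ B`, for some `u ≥ 0`. -/
theorem exists_forall_posPart_sub_le {ι : Type*} {Q : ι → G → ℝ} {C : ℝ}
    (hQ : ∀ i a b, Q i a ≤ Q i b + C * ‖a - b‖) {B : Set G} (hB0 : ∀ x ∈ B, 0 ≤ x)
    (hBs : ∀ x ∈ B, ∀ y, 0 ≤ y → y ≤ x → y ∈ B) {R : ℝ} (hBR : ∀ x ∈ B, ‖x‖ ≤ R)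
    (h : ∀ (z : ℕ → G) (i : ℕ → ι), (∀ n, z n ∈ B) → DisjointSeq z →
      Tendsto (fun n => Q (i n) (z n)) atTop (𝓝 0)) {ε : ℝ} (hε : 0 < ε) :
    ∃ u : G, 0 ≤ u ∧ ∀ x ∈ B, ∀ i, Q i (x - u)⁺ ≤ ε := by
  by_contra! hcon
  have hcon' : ∀ u : G, ∃ p : G × ι, 0 ≤ u → p.1 ∈ B ∧ ε < Q p.2 (p.1 - u)⁺ := by
    intro u
    by_cases hu : 0 ≤ u
    · obtain ⟨x, hx, i, hi⟩ := hcon u hu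
      exact ⟨(x, i), fun _ => ⟨hx, hi⟩⟩
    · obtain ⟨x, hx, i, hi⟩ := hcon 0 le_rfl
      exact ⟨(x, i), fun h => absurd h hu⟩
  choose p hp using hcon'
  set s : ℕ → G := recSum fun u => (p u).1 with hs
  have hs1 : ∀ n, s (n + 1) = s n + (p ((4 : ℝ) ^ n • s n)).1 := fun n => rfl
  have h4 : ∀ n : ℕ, (0 : ℝ) ≤ 4 ^ n := fun n => by positivity
  have h2 : ∀ n : ℕ, (0 : ℝ) ≤ (2⁻¹ : ℝ) ^ n := fun n => by positivity
  have hs0 : ∀ n, 0 ≤ s n := by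
    intro n
    induction n with
    | zero => exact le_rfl
    | succ n ih =>
      rw [hs1]
      exact add_nonneg ih (hB0 _ (hp _ (smul_nonneg (h4 n) ih)).1)
  set x : ℕ → G := fun n => (p ((4 : ℝ) ^ n • s n)).1 with hx
  have hxB : ∀ n, x n ∈ B := fun n => (hp _ (smul_nonneg (h4 n) (hs0 n))).1
  have hx0 : ∀ n, 0 ≤ x n := fun n => hB0 _ (hxB n)
  have hsx : ∀ m n, m < n → x m ≤ s n := by
    intro m n hmn
    induction n, hmn using Nat.le_induction with
    | base =>
      rw [hs1]
      exact le_add_of_nonneg_left (hs0 m)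
    | succ n _ ih =>
      rw [hs1]
      exact ih.trans (le_add_of_nonneg_right (hx0 n))
  have hsum : Summable fun n => (2⁻¹ : ℝ) ^ n • x n := by
    refine Summable.of_norm_bounded (g := fun n => (2⁻¹ : ℝ) ^ n * R)
      ((summable_geometric_of_lt_one (by norm_num) (by norm_num)).mul_right R) fun n => ?_
    rw [norm_smul, Real.norm_of_nonneg (h2 n)]
    exact mul_le_mul_of_nonneg_left (hBR _ (hxB n)) (h2 n)
  set y : G := ∑' n, (2⁻¹ : ℝ) ^ n • x n with hy
  have hyx : ∀ n, (2⁻¹ : ℝ) ^ n • x n ≤ y := fun n =>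
    hsum.le_tsum n fun j _ => smul_nonneg (h2 j) (hx0 j)
  have hy0 : 0 ≤ y := (smul_nonneg (h2 0) (hx0 0)).trans (hyx 0)
  -- Subtracting `4 ^ n • s n` separates `x n` from the earlier terms, and `2⁻¹ ^ n • y` from the
  -- later ones; the second correction is norm-small, so `Q` barely notices it.
  set w : ℕ → G := fun n => (x n - (4 : ℝ) ^ n • s n - (2⁻¹ : ℝ) ^ n • y)⁺ with hw
  have hw0 : ∀ n, 0 ≤ w n := fun n => posPart_nonneg _
  have hwx : ∀ n, w n ≤ x n := fun n => by
    refine posPart_le ?_ (hx0 n)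
    rw [sub_sub]
    exact sub_le_self _ (add_nonneg (smul_nonneg (h4 n) (hs0 n)) (smul_nonneg (h2 n) hy0))
  have hwd : DisjointSeq w := by
    refine disjointSeq_of_lt hw0 fun m n hmn => ?_
    refine inf_eq_zero_of_smul (c := 4 ^ n) (one_le_pow₀ (by norm_num)) (hw0 m) (hw0 n)
      (a' := ((4 : ℝ) ^ n • x m - x n)⁺) (b' := (x n - (4 : ℝ) ^ n • x m)⁺) ?_ ?_
      (posPart_sub_inf_posPart_sub _ _)
    · refine smul_posPart_le (by positivity) ?_
      rw [smul_sub, smul_sub]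
      refine sub_le_sub (sub_le_self _ (smul_nonneg (h4 n) (smul_nonneg (h4 m) (hs0 m)))) ?_
      rw [smul_smul]
      -- For `m < n` this makes `4 ^ n • 2⁻¹ ^ m • y` dominate `x n`, so that `4 ^ n • w m` lies
      -- below `(4 ^ n • x m - x n)⁺`.
      have h1 : (2 : ℝ) ^ n ≤ 4 ^ n * 2⁻¹ ^ m := by
        have : (4 : ℝ) ^ n = 2 ^ n * 2 ^ n := by rw [← mul_pow]; norm_num
        rw [this, mul_assoc, inv_pow]
        refine le_mul_of_one_le_right (by positivity) ?_
        rw [← div_eq_mul_inv, one_le_div (by positivity)]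
        exact pow_le_pow_right₀ (by norm_num) hmn.le
      calc x n = (2 : ℝ) ^ n • (2⁻¹ : ℝ) ^ n • x n := by
            rw [smul_smul, ← mul_pow]; norm_num
        _ ≤ (2 : ℝ) ^ n • y := smul_le_smul_of_nonneg_left (hyx n) (by positivity)
        _ ≤ (4 ^ n * 2⁻¹ ^ m : ℝ) • y := smul_le_smul_of_nonneg_right h1 hy0
    · refine posPart_mono ?_
      rw [sub_sub]
      refine sub_le_sub_left ?_ _
      exact le_add_of_le_of_nonneg (smul_le_smul_of_nonneg_left (hsx m n hmn) (h4 n))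
        (smul_nonneg (h2 n) hy0)
  have hlim := h w (fun n => (p ((4 : ℝ) ^ n • s n)).2)
    (fun n => hBs _ (hxB n) _ (hw0 n) (hwx n)) hwd
  have hlow : ∀ n, ε ≤ Q (p ((4 : ℝ) ^ n • s n)).2 (w n) + |C| * ((2⁻¹ : ℝ) ^ n * ‖y‖) := by
    intro n
    refine (hp _ (smul_nonneg (h4 n) (hs0 n))).2.le.trans ((hQ _ _ (w n)).trans ?_)
    gcongr
    · exact le_abs_self C
    · refine (norm_posPart_sub_posPart_le _ _).trans (le_of_eq ?_)
      rw [sub_sub_cancel, norm_smul, Real.norm_of_nonneg (h2 n)]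
  have hlim2 : Tendsto (fun n => Q (p ((4 : ℝ) ^ n • s n)).2 (w n) +
      |C| * ((2⁻¹ : ℝ) ^ n * ‖y‖)) atTop (𝓝 (0 + |C| * (0 * ‖y‖))) :=
    hlim.add (((tendsto_pow_atTop_nhds_zero_of_lt_one (by norm_num)
      (by norm_num)).mul_const _).const_mul _)
  have := ge_of_tendsto' hlim2 hlow
  simp at this
  linarith

end DisjointSequence


/-! ### Functionals on a Banach lattice -/

section Functionals

variable {E : Type*} [NormedAddCommGroup E] [NormedSpace ℝ E] [Lattice E] [HasSolidNorm E]
  [IsOrderedAddMonoid E]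

lemma apply_nonneg {f : StrongDual ℝ E} (hf : 0 ≤ f) {x : E} (hx : 0 ≤ x) : 0 ≤ f x := hf x hx

lemma apply_mono {f : StrongDual ℝ E} (hf : 0 ≤ f) {x y : E} (h : x ≤ y) : f x ≤ f y := by
  have := hf (y - x) (sub_nonneg.2 h)
  rw [map_sub] at this
  simpa using this

lemma apply_le_norm_mul (f : StrongDual ℝ E) (x : E) : f x ≤ ‖f‖ * ‖x‖ :=
  (le_abs_self _).trans (f.le_opNorm x)

lemma abs_apply_le_of_abs_le {f g : StrongDual ℝ E} (h : |g| ≤ f) (x : E) : |g x| ≤ f |x| :=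
  (DualLattice.abs_apply_le g x).trans (h _ (abs_nonneg x))

lemma weaklyNull_of_nonneg {x : ℕ → E}
    (h : ∀ f : StrongDual ℝ E, 0 ≤ f → Tendsto (fun n => f (x n)) atTop (𝓝 0)) :
    WeaklyNull x := fun φ => by
  have := (h φ⁺ (posPart_nonneg φ)).sub (h φ⁻ (negPart_nonneg φ))
  rw [sub_zero] at this
  refine this.congr fun n => ?_
  rw [← sub_apply, posPart_sub_negPart]

lemma _root_.WeaklyNull.of_nonneg_of_le {x y : ℕ → E} (hx : WeaklyNull x) (hy : ∀ n, 0 ≤ y n)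
    (h : ∀ n, y n ≤ x n) : WeaklyNull y :=
  weaklyNull_of_nonneg fun f hf => squeeze_zero (fun n => apply_nonneg hf (hy n))
    (fun n => apply_mono hf (h n)) (hx f)

/-- Order bounded disjoint sequences are weakly null. -/
lemma weaklyNull_of_disjoint_of_le {x : ℕ → E} (hx : ∀ n, 0 ≤ x n) (hd : DisjointSeq x) {u : E}
    (hu : ∀ n, x n ≤ u) : WeaklyNull x := by
  refine weaklyNull_of_nonneg fun f hf => ?_
  -- Disjointness keeps the partial sums below `u`, so the values of `f` form a convergent series.
  refine (summable_of_sum_range_le (c := f u) (fun n => apply_nonneg hf (hx n))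
    fun n => ?_).tendsto_atTop_zero
  rw [← map_sum]
  exact apply_mono hf (sum_le_of_pairwise_inf hx ((hx 0).trans (hu 0)) hu _
    fun i j hij => hd.inf_of_nonneg hx hij)

/-- Disjoint sequences are `uaw`-null. -/
lemma uawNull_of_disjoint {x : ℕ → E} (hd : DisjointSeq x) : UawNull x := fun u hu =>
  weaklyNull_of_disjoint_of_le (u := u) (fun n => le_inf (abs_nonneg _) hu)
    (hd.of_le fun n => by
      rw [abs_of_nonneg (le_inf (abs_nonneg _) hu)]
      exact inf_le_left) fun n => inf_le_right

/-- Disjointness means `f = (f - g)⁺`, so the Riesz–Kantorovich formula gives a `y` at which `(f -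
g) y` nearly attains `f x`. -/
lemma exists_apply_add_lt_of_inf_eq_zero {f g : StrongDual ℝ E} (h : f ⊓ g = 0) {x : E}
    (hx : 0 ≤ x) {δ : ℝ} (hδ : 0 < δ) : ∃ y ∈ Icc 0 x, f (x - y) + g y < δ := by
  have h1 : f = DualLattice.pos (f - g) := sub_eq_zero.1 h
  have h2 : f x = sSup ((f - g) '' Icc 0 x) := by
    rw [← DualLattice.pos_apply _ hx, ← h1]
  obtain ⟨_, ⟨y, hy, rfl⟩, hlt⟩ := exists_lt_of_lt_csSup
    (s := (f - g) '' Icc 0 x) ⟨_, 0, ⟨le_rfl, hx⟩, rfl⟩ (h2 ▸ sub_lt_self (f x) hδ)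
  refine ⟨y, hy, ?_⟩
  rw [sub_apply] at hlt
  rw [map_sub]
  linarith

/-- Each pair of functionals is nearly separated by some `y i j`. Removing from `x` the corrections
for all `j ≠ i` makes the remainders disjoint at a cost of at most `2 * δ` per pair. -/
lemma exists_disjoint_of_finite {ι : Type*} [Fintype ι] {f : ι → StrongDual ℝ E}
    (hf : ∀ i, 0 ≤ f i) (hd : ∀ i j, i ≠ j → f i ⊓ f j = 0) {x : E} (hx : 0 ≤ x) {η : ℝ}
    (hη : 0 < η) : ∃ a : ι → E, (∀ i, 0 ≤ a i) ∧ (∀ i, a i ≤ x) ∧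
      (∀ i j, i ≠ j → a i ⊓ a j = 0) ∧ ∀ i, f i x - η ≤ f i (a i) := by
  classical
  -- Fewer than `card ι + 1` corrections cost at most `2 * δ` each; the `+ 1` keeps the denominator
  -- nonzero.
  set δ : ℝ := η / (2 * (Fintype.card ι + 1)) with hδ
  have hδ0 : 0 < δ := by positivity
  have hy : ∀ i j, ∃ y ∈ Icc 0 x, i ≠ j → f i (x - y) + f j y < δ := by
    intro i j
    by_cases hij : i = j
    · exact ⟨0, ⟨le_rfl, hx⟩, fun h => absurd hij h⟩
    · obtain ⟨y, hy, h⟩ := exists_apply_add_lt_of_inf_eq_zero (hd i j hij) hx hδ0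
      exact ⟨y, hy, fun _ => h⟩
  choose y hy hlt using hy
  have ht : ∀ i j, 0 ≤ x - y i j + y j i := fun i j =>
    add_nonneg (sub_nonneg.2 (hy i j).2) (hy j i).1
  refine ⟨fun i => (x - ∑ j ∈ Finset.univ.erase i, (x - y i j + y j i))⁺,
    fun i => posPart_nonneg _, fun i => posPart_sub_le hx (Finset.sum_nonneg fun j _ => ht i j),
    fun i j hij => ?_, fun i => ?_⟩
  · have key : ∀ i j, i ≠ j → (x - ∑ j ∈ Finset.univ.erase i, (x - y i j + y j i))⁺ ≤
        (y i j - y j i)⁺ := fun i j hij => by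
      refine posPart_mono ?_
      have := Finset.single_le_sum (f := fun j => x - y i j + y j i) (fun j _ => ht i j)
        (Finset.mem_erase.2 ⟨hij.symm, Finset.mem_univ j⟩)
      refine (sub_le_sub_left this x).trans (le_of_eq ?_)
      abel
    exact inf_eq_zero_of_le (posPart_nonneg _) (posPart_nonneg _) (key i j hij)
      (key j i hij.symm) (posPart_sub_inf_posPart_sub _ _)
  · refine le_trans ?_ (apply_mono (hf i) (le_posPart _))
    rw [map_sub, map_sum]
    refine sub_le_sub_left ?_ _
    have h1 : ∀ j ∈ Finset.univ.erase i, f i (x - y i j + y j i) ≤ 2 * δ := by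
      intro j hj
      have hij := (Finset.ne_of_mem_erase hj).symm
      have h1 := hlt i j hij
      have h2 := hlt j i hij.symm
      have h3 := apply_nonneg (hf j) (hy i j).1
      have h4 := apply_nonneg (hf j) (sub_nonneg.2 (hy j i).2)
      rw [map_add]
      linarith
    refine (Finset.sum_le_card_nsmul _ _ _ h1).trans ?_
    rw [nsmul_eq_mul]
    have hc : ((Finset.univ.erase i).card : ℝ) ≤ Fintype.card ι + 1 := by
      have : (Finset.univ.erase i).card ≤ Fintype.card ι := Finset.card_erase_le
      have : ((Finset.univ.erase i).card : ℝ) ≤ Fintype.card ι := by exact_mod_cast this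
      linarith
    calc ((Finset.univ.erase i).card : ℝ) * (2 * δ) ≤ (Fintype.card ι + 1) * (2 * δ) := by gcongr
      _ = η := by rw [hδ]; field_simp

end Functionals

/-! ### From disjoint functionals to disjoint elements of an order interval -/

section Peeling

variable {E : Type*} [NormedAddCommGroup E] [NormedSpace ℝ E] [Lattice E] [HasSolidNorm E]
  [IsOrderedAddMonoid E] [IsOrderedModule ℝ E]

/-- One step of an extraction: a piece `z` of `x` on which one functional is large is split off,
while infinitely many functionals stay large on the disjoint remainder `x'`. -/
lemma exists_disjoint_split {f : ℕ → StrongDual ℝ E} (hf : ∀ n, 0 ≤ f n)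
    (hd : ∀ m n, m ≠ n → f m ⊓ f n = 0) {x : E} (hx : 0 ≤ x) {C : ℝ} (hC : 0 < C)
    (hfC : ∀ n, f n x ≤ C) {I : Set ℕ} (hI : I.Infinite) {c δ : ℝ} (hδ : 0 < δ)
    (h : ∀ n ∈ I, c + δ ≤ f n x) :
    ∃ (z x' : E) (i : ℕ) (I' : Set ℕ), 0 ≤ z ∧ z ≤ x ∧ 0 ≤ x' ∧ x' ≤ x ∧ z ⊓ x' = 0 ∧
      I'.Infinite ∧ c ≤ f i z ∧ ∀ n ∈ I', c + δ / 2 ≤ f n x' := by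
  -- `M` makes the loss `C / M` in `z` at most `δ / 4`; then `N` makes the loss `M * (C / N)` in
  -- `x'` at most `δ / 2`.
  obtain ⟨M, hM⟩ := exists_nat_gt (max 1 (4 * C / δ))
  have hM1 : (1 : ℝ) ≤ M := (le_max_left _ _).trans hM.le
  have hM0 : (0 : ℝ) < M := by linarith
  have hMC : (M : ℝ)⁻¹ * C ≤ δ / 4 := by
    have : 4 * C / δ < M := (le_max_right _ _).trans_lt hM
    rw [div_lt_iff₀ hδ] at this
    rw [inv_mul_le_iff₀ hM0]
    linarith
  obtain ⟨N, hN⟩ := exists_nat_gt (2 * (M * C) / δ)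
  have hN0 : (0 : ℝ) < N := lt_of_le_of_lt (by positivity) hN
  have hNC : M * (C / N) ≤ δ / 2 := by
    rw [div_lt_iff₀ hδ] at hN
    rw [← mul_div_assoc, div_le_iff₀ hN0]
    linarith
  let k : Fin N → ℕ := fun j => hI.natEmbedding I j
  have hkI : ∀ j, k j ∈ I := fun j => (hI.natEmbedding I j).2
  have hk : Function.Injective k := fun i j hij =>
    Fin.ext ((hI.natEmbedding I).injective (Subtype.ext hij))
  obtain ⟨a, ha0, hax, had, haf⟩ := exists_disjoint_of_finite (fun j => hf (k j))
    (fun i j hij => hd _ _ (hk.ne hij)) hx (show 0 < δ / 4 by positivity)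
  -- The `N` disjoint pieces add up to at most `x`, so each `f n` is small on one of them; by
  -- pigeonhole one piece serves infinitely many `n`.
  have hpig : ∀ n ∈ I, ∃ j, f n (a j) ≤ C / N := by
    intro n _
    by_contra! hcon
    have h1 : f n (∑ j, a j) ≤ C :=
      (apply_mono (hf n) (sum_le_of_pairwise_inf ha0 hx hax _ had)).trans (hfC n)
    rw [map_sum] at h1
    have : NeZero N := ⟨fun h => by simp [h] at hN0⟩
    have h2 : ∑ _j : Fin N, C / N < ∑ j, f n (a j) :=
      Finset.sum_lt_sum_of_nonempty Finset.univ_nonempty fun j _ => hcon j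
    rw [Finset.sum_const, Finset.card_univ, Fintype.card_fin, nsmul_eq_mul,
      mul_div_cancel₀ _ hN0.ne'] at h2
    linarith
  obtain ⟨j, hj⟩ : ∃ j, {n | n ∈ I ∧ f n (a j) ≤ C / N}.Infinite := by
    by_contra! hcon
    refine hI ((Set.finite_iUnion fun j => hcon j).subset fun n hn => ?_)
    obtain ⟨j, hj⟩ := hpig n hn
    exact mem_iUnion.2 ⟨j, hn, hj⟩
  -- These are disjoint because `M` times the first is `(M • a j - x)⁺`.
  refine ⟨(a j - (M : ℝ)⁻¹ • x)⁺, (x - (M : ℝ) • a j)⁺, k j, _, posPart_nonneg _,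
    (posPart_sub_le (ha0 j) (smul_nonneg (inv_nonneg.2 hM0.le) hx)).trans (hax j),
    posPart_nonneg _, posPart_sub_le hx (smul_nonneg hM0.le (ha0 j)), ?_, hj, ?_, ?_⟩
  · refine inf_eq_zero_of_smul hM1 (posPart_nonneg _) (posPart_nonneg _)
      (smul_posPart_le hM0 (le_of_eq ?_)) le_rfl (posPart_sub_inf_posPart_sub ((M : ℝ) • a j) x)
    rw [smul_sub, smul_inv_smul₀ hM0.ne']
  · refine le_trans ?_ (apply_mono (hf (k j)) (le_posPart _))
    rw [map_sub, map_smul, smul_eq_mul]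
    have h1 := haf j
    have h2 := h _ (hkI j)
    have h3 : (M : ℝ)⁻¹ * f (k j) x ≤ (M : ℝ)⁻¹ * C :=
      mul_le_mul_of_nonneg_left (hfC _) (inv_nonneg.2 hM0.le)
    linarith
  · rintro n ⟨hn, hle⟩
    refine le_trans ?_ (apply_mono (hf n) (le_posPart _))
    rw [map_sub, map_smul, smul_eq_mul]
    have h1 := h n hn
    have h2 : (M : ℝ) * f n (a j) ≤ M * (C / N) := mul_le_mul_of_nonneg_left hle hM0.le
    linarith

/-- If a bounded sequence of disjoint positive functionals tends to zero uniformly along the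
disjoint sequences in `[0, w]`, then it tends to zero at `w`. -/
theorem tendsto_apply_zero_of_disjoint {f : ℕ → StrongDual ℝ E} (hf : ∀ n, 0 ≤ f n)
    (hd : ∀ m n, m ≠ n → f m ⊓ f n = 0) {w : E} (hw : 0 ≤ w) {C : ℝ} (hfC : ∀ n, f n w ≤ C)
    (h : ∀ z : ℕ → E, (∀ n, z n ∈ Icc 0 w) → DisjointSeq z → ∀ i : ℕ → ℕ,
      Tendsto (fun n => f (i n) (z n)) atTop (𝓝 0)) :
    Tendsto (fun n => f n w) atTop (𝓝 0) := by
  by_contra hcon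
  obtain ⟨ε, hε, hinf⟩ : ∃ ε > 0, {n | ε ≤ f n w}.Infinite := by
    by_contra! hfin
    refine hcon (tendsto_order.2 ⟨fun a ha => Eventually.of_forall fun n =>
      ha.trans_le (apply_nonneg (hf n) hw), fun a ha => ?_⟩)
    have := (Nat.frequently_atTop_iff_infinite.not.2 (Set.not_infinite.2 (hfin a ha)))
    simpa using this
  set D : ℝ := max C 1 with hD
  have hD0 : 0 < D := lt_of_lt_of_le one_pos (le_max_right _ _)
  -- A state is a remainder and an infinite set of indices. The slack `δ` halves at each step but
  -- stays positive, so the bound `ε / 2` survives forever.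
  let S : Type _ := {q : E × Set ℕ // 0 ≤ q.1 ∧ q.1 ≤ w ∧ q.2.Infinite ∧
    ∃ δ > 0, ∀ n ∈ q.2, ε / 2 + δ ≤ f n q.1}
  have hstep : ∀ q : S, ∃ (q' : S) (z : E) (i : ℕ), 0 ≤ z ∧ z ≤ q.1.1 ∧ q'.1.1 ≤ q.1.1 ∧
      z ⊓ q'.1.1 = 0 ∧ ε / 2 ≤ f i z := by
    rintro ⟨⟨x, I⟩, hx, hxw, hI, δ, hδ, hδI⟩
    obtain ⟨z, x', i, I', hz, hzx, hx', hxx', hzx', hI', hiz, hn⟩ :=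
      exists_disjoint_split hf hd hx hD0
        (fun n => ((apply_mono (hf n) hxw).trans (hfC n)).trans (le_max_left _ _)) hI hδ hδI
    exact ⟨⟨(x', I'), hx', hxx'.trans hxw, hI', δ / 2, half_pos hδ, hn⟩, z, i, hz, hzx, hxx',
      hzx', hiz⟩
  choose nxt z i hz0 hzq hnq hzn hiz using hstep
  let q0 : S := ⟨(w, _), hw, le_rfl, hinf, ε / 2, half_pos hε, fun n hn => by
    rw [add_halves]; exact hn⟩
  let q : ℕ → S := fun n => nxt^[n] q0
  have hq : ∀ n, q (n + 1) = nxt (q n) := fun n => Function.iterate_succ_apply' nxt n q0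
  have hanti : Antitone fun n => (q n).1.1 := antitone_nat_of_succ_le fun n => by
    rw [hq]
    exact hnq _
  have hlim := h (fun n => z (q n)) (fun n => ⟨hz0 _, (hzq _).trans (q n).2.2.1⟩)
    (disjointSeq_of_lt (fun n => hz0 _) fun m n hmn =>
      inf_eq_zero_of_le (hz0 _) (hz0 _) le_rfl ((hzq (q n)).trans (hanti hmn)) (by
        have := hzn (q m)
        rwa [← hq] at this)) fun n => i (q n)
  have := ge_of_tendsto' hlim fun n => hiz (q n)
  linarith

/-- If a bounded set `A` of functionals tends to zero uniformly along the disjoint sequences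
in `[0, w]`, then it is, up to `ε` at `w`, contained in an order interval. -/
theorem exists_forall_posPart_sub_apply_le {A : Set (StrongDual ℝ E)} {R : ℝ}
    (hA : ∀ h ∈ A, ‖h‖ ≤ R) {w : E} (hw : 0 ≤ w)
    (hz : ∀ (z : ℕ → E) (h : ℕ → StrongDual ℝ E), (∀ n, z n ∈ Icc 0 w) → DisjointSeq z →
      (∀ n, h n ∈ A) → Tendsto (fun n => |h n| (z n)) atTop (𝓝 0)) {ε : ℝ} (hε : 0 < ε) :
    ∃ g : StrongDual ℝ E, 0 ≤ g ∧ ∀ h ∈ A, (|h| - g)⁺ w ≤ ε := by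
  obtain ⟨g, hg, hgB⟩ := exists_forall_posPart_sub_le (ι := Unit)
    (Q := fun _ (f : StrongDual ℝ E) => f w) (C := ‖w‖) (fun _ a b => by
      have := apply_le_norm_mul (a - b) w
      rw [sub_apply] at this
      linarith)
    (B := {f : StrongDual ℝ E | 0 ≤ f ∧ ∃ h ∈ A, f ≤ |h|}) (fun x hx => hx.1)
    (fun x hx y hy hyx => ⟨hy, hx.2.imp fun h hh => ⟨hh.1, hyx.trans hh.2⟩⟩) (R := R)
    (fun x ⟨hx0, h, hh, hxh⟩ => by
      refine (norm_le_norm_of_nonneg hx0 hxh).trans ?_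
      rw [norm_abs_eq_norm]
      exact hA h hh)
    (fun f _ hfB hfd => by
      choose hf0 h hhA hfh using hfB
      refine tendsto_apply_zero_of_disjoint hf0 (fun m n hmn => hfd.inf_of_nonneg hf0 hmn) hw
        (C := R * ‖w‖) (fun n => ?_) fun z hzw hzd i => ?_
      · refine (apply_le_norm_mul _ _).trans ?_
        gcongr
        refine (norm_le_norm_of_nonneg (hf0 n) (hfh n)).trans ?_
        rw [norm_abs_eq_norm]
        exact hA _ (hhA n)
      · exact squeeze_zero (fun n => apply_nonneg (hf0 _) (hzw n).1)
          (fun n => hfh (i n) _ (hzw n).1) (hz z (fun n => h (i n)) hzw hzd fun n => hhA _)) hε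
  exact ⟨g, hg, fun h hh => hgB |h| ⟨abs_nonneg h, h, hh, le_rfl⟩ ()⟩

end Peeling

/-! ### Carrying a positive functional by a band -/

section Band

variable {E : Type*} [NormedAddCommGroup E] [NormedSpace ℝ E] [Lattice E] [HasSolidNorm E]
  [IsOrderedAddMonoid E]

/-- The extension is `x ↦ s x⁺ - s x⁻`; additivity and continuity make it real-linear. -/
lemma exists_dual_of_additive {s : E → ℝ} {C : ℝ}
    (hadd : ∀ a b, 0 ≤ a → 0 ≤ b → s (a + b) = s a + s b)
    (hC : ∀ a, 0 ≤ a → |s a| ≤ C * ‖a‖) : ∃ g : StrongDual ℝ E, ∀ a, 0 ≤ a → g a = s a := by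
  have hsub : ∀ a b c d, 0 ≤ a → 0 ≤ b → 0 ≤ c → 0 ≤ d → a - b = c - d →
      s a - s b = s c - s d := by
    intro a b c d ha hb hc hd h
    rw [sub_eq_sub_iff_add_eq_add] at h
    have := congrArg s h
    rw [hadd a d ha hd, hadd c b hc hb] at this
    linarith
  have h0 : s 0 = 0 := by
    have := hadd 0 0 le_rfl le_rfl
    rw [add_zero] at this
    linarith
  let φ : E →+ ℝ := AddMonoidHom.mk' (fun x => s x⁺ - s x⁻) fun x y => by
    rw [hsub _ _ (x⁺ + y⁺) (x⁻ + y⁻) (posPart_nonneg _) (negPart_nonneg _)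
      (add_nonneg (posPart_nonneg x) (posPart_nonneg y))
      (add_nonneg (negPart_nonneg x) (negPart_nonneg y)) (by
        rw [posPart_sub_negPart, add_sub_add_comm, posPart_sub_negPart, posPart_sub_negPart]),
      hadd _ _ (posPart_nonneg x) (posPart_nonneg y), hadd _ _ (negPart_nonneg x)
      (negPart_nonneg y)]
    ring
  have hφ : Continuous φ := by
    refine AddMonoidHomClass.continuous_of_bound φ (|C| + |C|) fun x => ?_
    have h1 : ∀ a : E, 0 ≤ a → ‖a‖ ≤ ‖x‖ → |s a| ≤ |C| * ‖x‖ := fun a ha hax =>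
      (hC a ha).trans (mul_le_mul (le_abs_self C) hax (norm_nonneg _) (abs_nonneg _))
    have h2 : ‖x⁻‖ ≤ ‖x‖ := by
      rw [← posPart_neg, ← norm_neg x]
      exact norm_posPart_le (-x)
    calc ‖s x⁺ - s x⁻‖ ≤ |s x⁺| + |s x⁻| := abs_sub _ _
      _ ≤ |C| * ‖x‖ + |C| * ‖x‖ := add_le_add (h1 _ (posPart_nonneg x) (norm_posPart_le x))
          (h1 _ (negPart_nonneg x) h2)
      _ = _ := by ring
  refine ⟨φ.toRealLinearMap hφ, fun a ha => ?_⟩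
  change s a⁺ - s a⁻ = s a
  rw [posPart_of_nonneg ha, negPart_of_nonneg ha, h0, sub_zero]

/-- The part of a positive functional carried by the band generated by a sequence. -/
theorem exists_band_part {f : StrongDual ℝ E} (hf : 0 ≤ f) {v : ℕ → E} (hv0 : ∀ k, 0 ≤ v k)
    (hv : ∀ k, v k + v k ≤ v (k + 1)) : ∃ g : StrongDual ℝ E, 0 ≤ g ∧ g ≤ f ∧
      ∀ x, 0 ≤ x → Tendsto (fun k => f (x ⊓ v k)) atTop (𝓝 (g x)) := by
  have hmono : Monotone v := monotone_nat_of_le_succ fun k =>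
    (le_add_of_nonneg_left (hv0 k)).trans (hv k)
  have hle : ∀ x k, f (x ⊓ v k) ≤ f x := fun x k => apply_mono hf inf_le_left
  have hlim : ∀ x, Tendsto (fun k => f (x ⊓ v k)) atTop (𝓝 (⨆ k, f (x ⊓ v k))) := fun x =>
    tendsto_atTop_ciSup (fun m n hmn => apply_mono hf (inf_le_inf_left x (hmono hmn)))
      ⟨f x, by rintro _ ⟨k, rfl⟩; exact hle x k⟩
  have hnn : ∀ x, 0 ≤ x → 0 ≤ ⨆ k, f (x ⊓ v k) := fun x hx =>
    Real.iSup_nonneg fun k => apply_nonneg hf (le_inf hx (hv0 k))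
  have hsf : ∀ x, ⨆ k, f (x ⊓ v k) ≤ f x := fun x => ciSup_le (hle x)
  obtain ⟨g, hg⟩ := exists_dual_of_additive (s := fun x => ⨆ k, f (x ⊓ v k)) (C := ‖f‖)
    (fun a b ha hb => by
      refine le_antisymm ?_ ?_
      · refine le_of_tendsto_of_tendsto' (hlim (a + b)) ((hlim a).add (hlim b)) fun k => ?_
        rw [← map_add]
        refine apply_mono hf ?_
        rw [inf_add, add_inf, add_inf]
        exact le_inf (le_inf inf_le_left (inf_le_right.trans (le_add_of_nonneg_left ha)))
          (le_inf (inf_le_right.trans (le_add_of_nonneg_right hb))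
            (inf_le_right.trans (le_add_of_nonneg_left (hv0 k))))
      -- Superadditivity uses the doubling `v k + v k ≤ v (k + 1)`, hence the shift of the index by
      -- one.
      · refine le_of_tendsto_of_tendsto' ((hlim a).add (hlim b))
          ((hlim (a + b)).comp (tendsto_add_atTop_nat 1)) fun k => ?_
        rw [← map_add]
        exact apply_mono hf (le_inf (add_le_add inf_le_left inf_le_left)
          ((add_le_add inf_le_right inf_le_right).trans (hv k))))
    (fun a ha => by
      rw [abs_of_nonneg (hnn a ha)]
      exact (hsf a).trans (apply_le_norm_mul f a))
  refine ⟨g, fun x hx => ?_, fun x hx => ?_, fun x hx => ?_⟩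
  · rw [hg x hx]
    exact hnn x hx
  · rw [hg x hx]
    exact hsf x
  · rw [hg x hx]
    exact hlim x

lemma nsmul_inf_eq_zero {a b : E} (ha : 0 ≤ a) (hb : 0 ≤ b) (h : a ⊓ b = 0) (n : ℕ) :
    (n • a) ⊓ b = 0 := by
  have := sum_inf_eq_zero (x := fun _ : ℕ => a) (fun _ => ha) hb (Finset.range n) fun _ _ => h
  simpa using this

/-- The part of a positive functional carried by the band generated by an increasing sequence of
positive elements. -/
lemma exists_band_part_of_monotone {f : StrongDual ℝ E} (hf : 0 ≤ f) {s : ℕ → E}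
    (hs0 : ∀ k, 0 ≤ s k) (hs : Monotone s) : ∃ g : StrongDual ℝ E, 0 ≤ g ∧ g ≤ f ∧
      (∀ x, 0 ≤ x → Tendsto (fun k => g (x - x ⊓ (2 ^ k • s k))) atTop (𝓝 0)) ∧
      (∀ x k, 0 ≤ x → x ≤ s k → g x = f x) ∧
      ∀ x, 0 ≤ x → (∀ k, s k ⊓ x = 0) → g x = 0 := by
  obtain ⟨g, hg0, hgf, hg⟩ := exists_band_part hf (v := fun k => 2 ^ k • s k)
    (fun k => nsmul_nonneg (hs0 k) _) (fun k => by
      rw [← two_nsmul, ← mul_nsmul, ← pow_succ]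
      exact nsmul_le_nsmul_right (hs (Nat.le_succ k)) _)
  -- On such `x` the sequence defining `g x` is eventually constant.
  have hgv : ∀ x k, 0 ≤ x → x ≤ 2 ^ k • s k → g x = f x := fun x k hx hxk => by
    refine tendsto_nhds_unique (hg x hx) (tendsto_const_nhds.congr' ?_)
    filter_upwards [eventually_ge_atTop k] with j hj
    rw [inf_of_le_left]
    exact hxk.trans ((nsmul_le_nsmul_right (hs hj) _).trans
      (nsmul_le_nsmul_left (hs0 j) (Nat.pow_le_pow_right two_pos hj)))
  refine ⟨g, hg0, hgf, fun x hx => ?_, fun x k hx hxk => hgv x k hx (hxk.trans ?_),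
    fun x hx hxs => ?_⟩
  · have := (tendsto_const_nhds (x := g x)).sub (hg x hx)
    rw [sub_self] at this
    refine this.congr fun k => ?_
    rw [map_sub, hgv (x ⊓ 2 ^ k • s k) k (le_inf hx (nsmul_nonneg (hs0 k) _)) inf_le_right]
  · have := nsmul_le_nsmul_left (hs0 k) (Nat.one_le_two_pow (n := k))
    rwa [one_nsmul] at this
  · refine tendsto_nhds_unique (hg x hx) (tendsto_const_nhds.congr fun k => ?_)
    rw [inf_comm, nsmul_inf_eq_zero (hs0 k) hx (hxs k), map_zero]

/-- For `0 ≤ f`, `f |y| = max {g y : |g| ≤ f}`. -/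
lemma exists_apply_eq_apply_abs {f : StrongDual ℝ E} (hf : 0 ≤ f) (y : E) :
    ∃ g ∈ Icc (-f) f, g y = f |y| := by
  obtain ⟨g, hg0, hgf, -, hgs, hgd⟩ := exists_band_part_of_monotone hf (s := fun _ => y⁺)
    (fun _ => posPart_nonneg y) monotone_const
  -- With `g` the part of `f` on the band of `y⁺`, this functional is `f` at `y⁺` and `-f` at `y⁻`.
  refine ⟨g + g - f, ⟨?_, ?_⟩, ?_⟩
  · rw [neg_le_sub_iff_le_add]
    exact le_add_of_nonneg_left (add_nonneg hg0 hg0)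
  · rw [sub_le_iff_le_add]
    exact add_le_add hgf hgf
  · have h1 := hgs y⁺ 0 (posPart_nonneg y) le_rfl
    have h2 := hgd y⁻ (negPart_nonneg y) fun _ => posPart_inf_negPart_eq_zero y
    have h3 : y = y⁺ - y⁻ := (posPart_sub_negPart y).symm
    rw [← posPart_add_negPart, map_add]
    conv_lhs => rw [h3]
    simp only [sub_apply, add_apply, map_sub, h1, h2]
    ring

/-- The part `g` of `f` carried by the band of all `(x i)⁺` agrees with `f` on these and kills every
`(x n)⁻`, so `f (x n)⁺ = g (x n)`. -/
lemma tendsto_apply_posPart_of_disjoint {x : ℕ → E} (hd : DisjointSeq x) (hx : WeaklyNull x)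
    {f : StrongDual ℝ E} (hf : 0 ≤ f) : Tendsto (fun n => f (x n)⁺) atTop (𝓝 0) := by
  have hxp : ∀ i, 0 ≤ (x i)⁺ := fun i => posPart_nonneg _
  obtain ⟨g, -, -, -, hgs, hgd⟩ := exists_band_part_of_monotone hf
    (s := fun k => ∑ i ∈ Finset.range k, (x i)⁺) (fun k => Finset.sum_nonneg fun i _ => hxp i)
    (monotone_nat_of_le_succ fun k => by
      rw [Finset.sum_range_succ]
      exact le_add_of_nonneg_right (hxp k))
  refine (hx g).congr fun n => ?_
  have h1 := hgs (x n)⁺ (n + 1) (hxp n)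
    (Finset.single_le_sum (f := fun i => (x i)⁺) (fun i _ => hxp i) (Finset.self_mem_range_succ n))
  have h2 := hgd (x n)⁻ (negPart_nonneg _) fun k =>
    sum_inf_eq_zero hxp (negPart_nonneg _) _ fun i _ => by
      rcases eq_or_ne i n with rfl | hin
      · exact posPart_inf_negPart_eq_zero _
      · refine inf_eq_zero_of_le (hxp i) (negPart_nonneg _) ?_ ?_ (hd i n hin)
        · exact posPart_le (le_abs_self _) (abs_nonneg _)
        · exact sup_le (neg_le_abs _) (abs_nonneg _)
  conv_lhs => rw [← posPart_sub_negPart (x n)]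
  rw [map_sub, h1, h2, sub_zero]

/-- The absolute values of a disjoint weakly null sequence are weakly null. -/
theorem weaklyNull_abs_of_disjoint {x : ℕ → E} (hd : DisjointSeq x) (hx : WeaklyNull x) :
    WeaklyNull fun n => |x n| := by
  refine weaklyNull_of_nonneg fun f hf => ?_
  have h1 := tendsto_apply_posPart_of_disjoint hd hx hf
  have h2 := tendsto_apply_posPart_of_disjoint (x := fun n => -x n)
    (hd.of_le fun n => (abs_neg _).le) (fun φ => by simpa using (hx φ).neg) hf
  have := h1.add h2
  rw [add_zero] at this
  refine this.congr fun n => ?_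
  rw [posPart_neg, ← map_add, posPart_add_negPart]

end Band


/-! ### L-weakly compact sets of functionals -/

section Functionals

variable {E : Type*} [NormedAddCommGroup E] [NormedSpace ℝ E] [Lattice E] [HasSolidNorm E]
  [IsOrderedAddMonoid E]

/-- From `|f| = -f + (f - -f)⁺`: if `y` nearly attains the supremum for the positive part, `z = y +
y - x` works. -/
lemma exists_abs_le_sub_lt_apply (f : StrongDual ℝ E) {x : E} (hx : 0 ≤ x) {δ : ℝ} (hδ : 0 < δ) :
    ∃ z, |z| ≤ x ∧ |f| x - δ < f z := by
  have h1 : |f| x = f (-x) + sSup ((f - -f) '' Icc 0 x) := by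
    rw [← DualLattice.pos_apply _ hx, map_neg, add_comm]
    have : |f| = -f + DualLattice.pos (f - -f) := rfl
    rw [this, add_apply, neg_apply]
    ring
  obtain ⟨_, ⟨y, hy, rfl⟩, hlt⟩ := exists_lt_of_lt_csSup
    (s := (f - -f) '' Icc 0 x) ⟨_, 0, ⟨le_rfl, hx⟩, rfl⟩ (sub_lt_self _ hδ)
  refine ⟨y + y - x, ?_, ?_⟩
  · rw [abs_le']
    constructor
    · rw [sub_le_iff_le_add]
      exact add_le_add hy.2 hy.2
    · rw [neg_sub]
      exact sub_le_self x (add_nonneg hy.1 hy.1)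
  · have h2 : (f - -f) y = f y + f y := by rw [sub_apply, neg_apply, sub_neg_eq_add]
    rw [h2] at hlt
    rw [map_sub, map_add, h1, map_neg]
    linarith

lemma tendsto_abs_apply_of_forall {h : ℕ → StrongDual ℝ E} {x : ℕ → E} (hx : ∀ n, 0 ≤ x n)
    (H : ∀ z : ℕ → E, (∀ n, |z n| ≤ x n) → Tendsto (fun n => h n (z n)) atTop (𝓝 0)) :
    Tendsto (fun n => |h n| (x n)) atTop (𝓝 0) := by
  choose z hz hlt using fun n => exists_abs_le_sub_lt_apply (h n) (hx n)
    (Nat.one_div_pos_of_nat (α := ℝ) (n := n))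
  have := (H z hz).add (tendsto_one_div_add_atTop_nhds_zero_nat (𝕜 := ℝ))
  rw [add_zero] at this
  exact squeeze_zero (fun n => apply_nonneg (abs_nonneg _) (hx n))
    (fun n => (sub_lt_iff_lt_add.1 (hlt n)).le) this

/-- Split `|x| = |x| ⊓ u + (|x| - u)⁺`. -/
lemma norm_le_add_apply {f : StrongDual ℝ E} (hf : 0 ≤ f) {u : E} (hu : 0 ≤ u) {ε : ℝ}
    (hε : 0 ≤ ε) (h : ∀ x, 0 ≤ x → ‖x‖ ≤ 1 → f (x - u)⁺ ≤ ε) : ‖f‖ ≤ ε + f u := by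
  refine f.opNorm_le_of_unit_norm (add_nonneg hε (apply_nonneg hf hu)) fun x hx => ?_
  have h1 := abs_apply_le_of_abs_le (abs_of_nonneg hf).le x
  have h2 := h |x| (abs_nonneg x) (by rw [norm_abs_eq_norm, hx])
  have h3 : f |x| = f (|x| ⊓ u) + f (|x| - u)⁺ := by rw [← map_add, inf_add_posPart_sub]
  have h4 : f (|x| ⊓ u) ≤ f u := apply_mono hf inf_le_right
  rw [Real.norm_eq_abs]
  linarith

/-- An L-weakly compact set of functionals tends to zero uniformly along the norm bounded
disjoint sequences. -/
theorem _root_.IsLWeaklyCompact.tendsto_abs_apply_abs {A : Set (StrongDual ℝ E)}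
    (hA : IsLWeaklyCompact A) {x : ℕ → E} (hd : DisjointSeq x) (hb : NormBoundedSeq x)
    {h : ℕ → StrongDual ℝ E} (hh : ∀ n, h n ∈ A) :
    Tendsto (fun n => |h n| |x n|) atTop (𝓝 0) := by
  obtain ⟨C, hC⟩ := hb
  choose g hg0 hgh hglim hgs hgd using fun n => exists_band_part_of_monotone (abs_nonneg (h n))
    (s := fun _ => |x n|) (fun _ => abs_nonneg (x n)) monotone_const
  -- Cut `y` at `2 ^ k • |x m|`: `g n` vanishes below the cut, and `g m` of the rest tends to zero.
  have hgdisj : DisjointSeq g := by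
    refine disjointSeq_of_lt hg0 fun m n hmn => le_antisymm (fun y hy => ?_)
      (le_inf (hg0 m) (hg0 n))
    refine ge_of_tendsto' (hglim m y hy) fun k => ?_
    have h0 : 0 ≤ y ⊓ 2 ^ k • |x m| := le_inf hy (nsmul_nonneg (abs_nonneg _) _)
    have h1 : (g m ⊓ g n) (y ⊓ 2 ^ k • |x m|) ≤ 0 := by
      refine ((inf_le_right : g m ⊓ g n ≤ g n) _ h0).trans (hgd n _ h0 fun _ => ?_).le
      rw [inf_comm]
      exact inf_eq_zero_of_le h0 (abs_nonneg _) inf_le_right le_rfl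
        (nsmul_inf_eq_zero (abs_nonneg _) (abs_nonneg _) (hd m n hmn.ne) _)
    have h2 := (inf_le_left : g m ⊓ g n ≤ g m) (y - y ⊓ 2 ^ k • |x m|) (sub_nonneg.2 inf_le_left)
    rw [map_sub] at h2
    linarith
  have hlim := (hA.2.2 g (fun n => ⟨h n, hh n, by rw [abs_of_nonneg (hg0 n)]; exact hgh n⟩)
    hgdisj).mul_const C
  rw [zero_mul] at hlim
  refine squeeze_zero (fun n => apply_nonneg (abs_nonneg _) (abs_nonneg _)) (fun n => ?_) hlim
  rw [← hgs n |x n| 0 (abs_nonneg _) le_rfl]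
  refine (apply_le_norm_mul _ _).trans ?_
  rw [norm_abs_eq_norm]
  exact mul_le_mul_of_nonneg_left (hC n) (norm_nonneg _)

/-- Any `z` with `|z n| ≤ |x n|` is again disjoint and weakly null, which allows passing from `h n`
to `|h n|`. -/
lemma _root_.IsAlmostLSet.tendsto_abs_apply_abs {A : Set (StrongDual ℝ E)} (hA : IsAlmostLSet A)
    {x : ℕ → E} (hd : DisjointSeq x) (hx : WeaklyNull x) {h : ℕ → StrongDual ℝ E}
    (hh : ∀ n, h n ∈ A) : Tendsto (fun n => |h n| |x n|) atTop (𝓝 0) := by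
  obtain ⟨R, hR⟩ := hA.1.exists_norm_le
  refine tendsto_abs_apply_of_forall (fun n => abs_nonneg _) fun z hz => ?_
  have hzd := hd.of_le hz
  have hzw : WeaklyNull z := weaklyNull_of_nonneg fun f hf =>
    squeeze_zero_norm (fun n => (abs_apply_le_of_abs_le (abs_of_nonneg hf).le _).trans
      (apply_mono hf (hz n))) (weaklyNull_abs_of_disjoint hd hx f)
  refine squeeze_zero_norm (fun n => ?_) (hA.2 z hzd hzw)
  refine le_ciSup (f := fun f : A => |f.1 (z n)|) ⟨R * ‖z n‖, ?_⟩ ⟨h n, hh n⟩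
  rintro _ ⟨f, rfl⟩
  exact (f.1.le_opNorm _).trans (mul_le_mul_of_nonneg_right (hR _ f.2) (norm_nonneg _))

lemma abs_le_of_mem_Icc_neg {f g : StrongDual ℝ E} (hg : g ∈ Icc (-f) f) : |g| ≤ f :=
  abs_le'.2 ⟨hg.2, neg_le.1 hg.1⟩

lemma isBounded_Icc_neg (f : StrongDual ℝ E) : Bornology.IsBounded (Icc (-f) f) :=
  isBounded_iff_forall_norm_le.2
    ⟨‖f‖, fun _ hg => norm_le_norm_of_abs_le_abs
      ((abs_le_of_mem_Icc_neg hg).trans (le_abs_self f))⟩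

lemma isAlmostLSet_Icc_neg (f : StrongDual ℝ E) : IsAlmostLSet (Icc (-f) f) := by
  refine ⟨isBounded_Icc_neg f, fun x hd hx => ?_⟩
  by_cases hf : (Icc (-f) f).Nonempty
  · obtain ⟨g, hg⟩ := hf
    have hf0 : 0 ≤ f := (abs_nonneg g).trans (abs_le_of_mem_Icc_neg hg)
    exact squeeze_zero (fun n => Real.iSup_nonneg fun _ => abs_nonneg _)
      (fun n => Real.iSup_le (fun h => abs_apply_le_of_abs_le (abs_le_of_mem_Icc_neg h.2) _)
        (apply_nonneg hf0 (abs_nonneg _))) (weaklyNull_abs_of_disjoint hd hx f)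
  -- The supremum over an empty interval is `0` by convention.
  · have : IsEmpty (Icc (-f) f) := isEmpty_coe_sort.2 (not_nonempty_iff_eq_empty.1 hf)
    simp [Real.iSup_of_isEmpty]

end Functionals

/-! ### Uniform convergence on sets of functionals over a complete lattice -/

section Complete

variable {E : Type*} [NormedAddCommGroup E] [NormedSpace ℝ E] [CompleteSpace E] [Lattice E]
  [IsOrderedAddMonoid E] [IsOrderedModule ℝ E] [HasSolidNorm E]

lemma exists_forall_abs_apply_posPart_sub_le {A : Set (StrongDual ℝ E)} {R : ℝ}
    (hA : ∀ h ∈ A, ‖h‖ ≤ R) {B : Set E} (hB0 : ∀ x ∈ B, 0 ≤ x)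
    (hBs : ∀ x ∈ B, ∀ y, 0 ≤ y → y ≤ x → y ∈ B) {R' : ℝ} (hBR : ∀ x ∈ B, ‖x‖ ≤ R')
    (H : ∀ (z : ℕ → E) (h : ℕ → StrongDual ℝ E), (∀ n, z n ∈ B) → DisjointSeq z →
      (∀ n, h n ∈ A) → Tendsto (fun n => |h n| (z n)) atTop (𝓝 0)) {ε : ℝ} (hε : 0 < ε) :
    ∃ u : E, 0 ≤ u ∧ ∀ x ∈ B, ∀ h ∈ A, |h| (x - u)⁺ ≤ ε := by
  obtain ⟨u, hu, huB⟩ := exists_forall_posPart_sub_le (ι := A)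
    (Q := fun h x => |h.1| x) (C := R) (fun h a b => by
      have h1 := apply_le_norm_mul |h.1| (a - b)
      have h2 : ‖|h.1|‖ * ‖a - b‖ ≤ R * ‖a - b‖ := by
        rw [norm_abs_eq_norm]
        exact mul_le_mul_of_nonneg_right (hA _ h.2) (norm_nonneg _)
      rw [map_sub] at h1
      linarith) hB0 hBs hBR (fun z i hz hd => H z (fun n => (i n).1) hz hd fun n => (i n).2) hε
  exact ⟨u, hu, fun x hx h hh => huB x hx ⟨h, hh⟩⟩

/-- A bounded set of functionals that tends to zero uniformly along the norm bounded disjoint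
sequences is L-weakly compact. -/
theorem isLWeaklyCompact_of_forall_tendsto {A : Set (StrongDual ℝ E)} (hne : A.Nonempty)
    (hA : Bornology.IsBounded A)
    (H : ∀ (x : ℕ → E) (h : ℕ → StrongDual ℝ E), DisjointSeq x → NormBoundedSeq x →
      (∀ n, h n ∈ A) → Tendsto (fun n => h n (x n)) atTop (𝓝 0)) : IsLWeaklyCompact A := by
  refine ⟨hne, hA, fun g hg hgd => ?_⟩
  obtain ⟨R, hR⟩ := hA.exists_norm_le
  choose h hhA hgh using hg
  have H' : ∀ (x : ℕ → E) (h : ℕ → StrongDual ℝ E), (∀ n, 0 ≤ x n) → DisjointSeq x →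
      NormBoundedSeq x → (∀ n, h n ∈ A) → Tendsto (fun n => |h n| (x n)) atTop (𝓝 0) := by
    rintro x h hx hd ⟨C, hC⟩ hh
    refine tendsto_abs_apply_of_forall hx fun z hz => H z h (hd.of_le fun n => ?_) ⟨C, fun n => ?_⟩
      hh
    · exact (hz n).trans (le_abs_self _)
    · rw [← norm_abs_eq_norm]
      exact (norm_le_norm_of_nonneg (abs_nonneg _) (hz n)).trans (hC n)
  refine tendsto_order.2 ⟨fun a ha => Eventually.of_forall fun n => ha.trans_le (norm_nonneg _),
    fun ε hε => ?_⟩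
  obtain ⟨u, hu, huA⟩ := exists_forall_abs_apply_posPart_sub_le hR
    (B := {x : E | 0 ≤ x ∧ ‖x‖ ≤ 1}) (fun x hx => hx.1)
    (fun x hx y hy hyx => ⟨hy, (norm_le_norm_of_nonneg hy hyx).trans hx.2⟩) (fun x hx => hx.2)
    (fun z h hz hd hh => H' z h (fun n => (hz n).1) hd ⟨1, fun n => (hz n).2⟩ hh) (half_pos hε)
  -- The norm of `g n` is at most `ε / 2 + |g n| u`, so only the value at the single element `u`
  -- remains to be controlled.
  have hgu := tendsto_apply_zero_of_disjoint (f := fun n => |g n|) (fun n => abs_nonneg _)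
    (fun m n hmn => hgd m n hmn) hu (C := R * ‖u‖) (fun n => by
      refine (apply_le_norm_mul _ _).trans ?_
      gcongr
      rw [norm_abs_eq_norm]
      exact (norm_le_norm_of_abs_le_abs (hgh n)).trans (hR _ (hhA n)))
    fun z hz hd i => squeeze_zero (fun n => apply_nonneg (abs_nonneg _) (hz n).1)
      (fun n => hgh (i n) _ (hz n).1) (H' z (fun n => h (i n)) (fun n => (hz n).1) hd
        ⟨‖u‖, fun n => norm_le_norm_of_nonneg (hz n).1 (hz n).2⟩ fun n => hhA _)
  filter_upwards [hgu.eventually_lt_const (half_pos hε)] with n hn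
  have := norm_le_add_apply (abs_nonneg (g n)) hu (half_pos hε).le fun x hx hx1 =>
    (hgh n _ (posPart_nonneg _)).trans (huA x ⟨hx, hx1⟩ _ (hhA n))
  rw [norm_abs_eq_norm] at this
  linarith

/-- If a bounded set of functionals tends to zero uniformly along the order bounded disjoint
sequences and along the disjoint sequences in a bounded downward closed set `B` of positive
elements, then it does so along the unbounded absolutely weakly null sequences in `B`. -/
theorem tendsto_abs_apply_of_inf_weaklyNull {A : Set (StrongDual ℝ E)}
    (hA : Bornology.IsBounded A) {B : Set E} (hB0 : ∀ x ∈ B, 0 ≤ x)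
    (hBs : ∀ x ∈ B, ∀ y, 0 ≤ y → y ≤ x → y ∈ B) {R : ℝ} (hBR : ∀ x ∈ B, ‖x‖ ≤ R)
    (hAB : ∀ (z : ℕ → E) (h : ℕ → StrongDual ℝ E), (∀ n, z n ∈ B) → DisjointSeq z →
      (∀ n, h n ∈ A) → Tendsto (fun n => |h n| (z n)) atTop (𝓝 0))
    (hAw : ∀ w, 0 ≤ w → ∀ (z : ℕ → E) (h : ℕ → StrongDual ℝ E), (∀ n, z n ∈ Icc 0 w) →
      DisjointSeq z → (∀ n, h n ∈ A) → Tendsto (fun n => |h n| (z n)) atTop (𝓝 0))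
    {y : ℕ → E} (hy : ∀ n, y n ∈ B) (hyu : ∀ u, 0 ≤ u → WeaklyNull fun n => y n ⊓ u)
    {h : ℕ → StrongDual ℝ E} (hh : ∀ n, h n ∈ A) :
    Tendsto (fun n => |h n| (y n)) atTop (𝓝 0) := by
  obtain ⟨C, hC⟩ := hA.exists_norm_le
  refine tendsto_order.2 ⟨fun a ha => Eventually.of_forall fun n => ha.trans_le
    (apply_nonneg (abs_nonneg _) (hB0 _ (hy n))), fun ε hε => ?_⟩
  have hε3 : 0 < ε / 3 := by positivity
  obtain ⟨u, hu, huA⟩ := exists_forall_abs_apply_posPart_sub_le hC hB0 hBs hBR hAB hε3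
  obtain ⟨g, hg, hgA⟩ := exists_forall_posPart_sub_apply_le hC hu (hAw u hu) hε3
  filter_upwards [(hyu u hu g).eventually_lt_const hε3] with n hn
  have h1 : |h n| (y n) = |h n| (y n ⊓ u) + |h n| (y n - u)⁺ := by
    rw [← map_add, inf_add_posPart_sub]
  have h2 := huA _ (hy n) _ (hh n)
  have h3 := abs_le_abs_sub_posPart (h n) g (y n ⊓ u) (le_inf (hB0 _ (hy n)) hu)
  rw [add_apply] at h3
  have h4 := apply_mono (posPart_nonneg (|h n| - g)) (inf_le_right : y n ⊓ u ≤ u)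
  have h5 := hgA _ (hh n)
  linarith

/-- Here the solid set is the positive part of a ball, and order bounded disjoint sequences are norm
bounded. -/
theorem _root_.IsLWeaklyCompact.tendsto_of_uawNull {A : Set (StrongDual ℝ E)}
    (hA : IsLWeaklyCompact A) {x : ℕ → E} (hb : NormBoundedSeq x) (hx : UawNull x)
    {h : ℕ → StrongDual ℝ E} (hh : ∀ n, h n ∈ A) :
    Tendsto (fun n => |h n| |x n|) atTop (𝓝 0) := by
  obtain ⟨C, hC⟩ := hb
  have H : ∀ (z : ℕ → E) (h : ℕ → StrongDual ℝ E), (∀ n, 0 ≤ z n) → NormBoundedSeq z →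
      DisjointSeq z → (∀ n, h n ∈ A) → Tendsto (fun n => |h n| (z n)) atTop (𝓝 0) :=
    fun z h hz hzb hd hh => (hA.tendsto_abs_apply_abs hd hzb hh).congr fun n => by
      rw [abs_of_nonneg (hz n)]
  exact tendsto_abs_apply_of_inf_weaklyNull hA.2.1 (B := {x : E | 0 ≤ x ∧ ‖x‖ ≤ C})
    (fun x hx => hx.1)
    (fun x hx y hy hyx => ⟨hy, (norm_le_norm_of_nonneg hy hyx).trans hx.2⟩) (fun x hx => hx.2)
    (fun z h hz hd hh => H z h (fun n => (hz n).1) ⟨C, fun n => (hz n).2⟩ hd hh)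
    (fun w _ z h hz hd hh => H z h (fun n => (hz n).1)
      ⟨‖w‖, fun n => norm_le_norm_of_nonneg (hz n).1 (hz n).2⟩ hd hh)
    (fun n => ⟨abs_nonneg _, by rw [norm_abs_eq_norm]; exact hC n⟩) hx hh

/-- A disjoint sequence in the solid hull of a positive weakly null sequence is weakly null. -/
lemma weaklyNull_of_disjoint_of_exists_le {y : ℕ → E} (hy : WeaklyNull y) (hy0 : ∀ n, 0 ≤ y n)
    {z : ℕ → E} (hz0 : ∀ n, 0 ≤ z n) (hd : DisjointSeq z) (hz : ∀ n, ∃ k, z n ≤ y k) :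
    WeaklyNull z := by
  choose k hk using hz
  refine weaklyNull_of_nonneg fun f hf => tendsto_order.2 ⟨fun a ha =>
    Eventually.of_forall fun n => ha.trans_le (apply_nonneg hf (hz0 n)), fun ε hε => ?_⟩
  obtain ⟨N, hN⟩ := eventually_atTop.1 ((hy f).eventually_lt_const hε)
  -- A term dominated by a late `y k` is small under `f`; one dominated by an early `y k` lies below
  -- `w`, where order bounded disjoint sequences are weakly null.
  set w : E := ∑ j ∈ Finset.range N, y j with hw
  have hw0 : 0 ≤ w := Finset.sum_nonneg fun j _ => hy0 j
  have hzw := weaklyNull_of_disjoint_of_le (x := fun n => z n ⊓ w) (u := w)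
    (fun n => le_inf (hz0 n) hw0) (hd.of_le fun n => by
      rw [abs_of_nonneg (le_inf (hz0 n) hw0), abs_of_nonneg (hz0 n)]
      exact inf_le_left) (fun n => inf_le_right) f
  filter_upwards [hzw.eventually_lt_const hε] with n hn
  rcases lt_or_ge (k n) N with hkN | hkN
  · rwa [inf_of_le_left ((hk n).trans (Finset.single_le_sum (f := y) (fun j _ => hy0 j)
      (Finset.mem_range.2 hkN)))] at hn
  · exact (apply_mono hf (hk n)).trans_lt (hN _ hkN)

/-- Removes disjointness from the definition for positive sequences: disjoint sequences under the
terms of `y` are weakly null, as are order bounded ones. -/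
theorem _root_.IsAlmostLSet.tendsto_of_weaklyNull {A : Set (StrongDual ℝ E)}
    (hA : IsAlmostLSet A) {y : ℕ → E} (hb : NormBoundedSeq y) (hy : WeaklyNull y)
    (hy0 : ∀ n, 0 ≤ y n) {h : ℕ → StrongDual ℝ E} (hh : ∀ n, h n ∈ A) :
    Tendsto (fun n => |h n| (y n)) atTop (𝓝 0) := by
  obtain ⟨C, hC⟩ := hb
  have H : ∀ (z : ℕ → E) (h : ℕ → StrongDual ℝ E), (∀ n, 0 ≤ z n) → WeaklyNull z →
      DisjointSeq z → (∀ n, h n ∈ A) → Tendsto (fun n => |h n| (z n)) atTop (𝓝 0) :=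
    fun z h hz hzw hd hh => (hA.tendsto_abs_apply_abs hd hzw hh).congr fun n => by
      rw [abs_of_nonneg (hz n)]
  exact tendsto_abs_apply_of_inf_weaklyNull hA.1 (B := {x : E | 0 ≤ x ∧ ∃ n, x ≤ y n})
    (fun x hx => hx.1)
    (fun x hx z hz hzx => ⟨hz, hx.2.imp fun n hn => hzx.trans hn⟩)
    (fun x ⟨hx, n, hn⟩ => (norm_le_norm_of_nonneg hx hn).trans (hC n))
    (fun z h hz hd hh => H z h (fun n => (hz n).1)
      (weaklyNull_of_disjoint_of_exists_le hy hy0 (fun n => (hz n).1) hd fun n => (hz n).2) hd hh)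
    (fun w _ z h hz hd hh => H z h (fun n => (hz n).1)
      (weaklyNull_of_disjoint_of_le (fun n => (hz n).1) hd fun n => (hz n).2) hd hh)
    (fun n => ⟨hy0 n, n, le_rfl⟩)
    (fun u hu => hy.of_nonneg_of_le (fun n => le_inf (hy0 n) hu) fun n => inf_le_left) hh

end Complete

/-! ### Order continuity of the dual norm -/

section OrderContinuity

/-- The pointwise infimum of a decreasing net is a limit, hence additive on the positive cone. -/
lemma exists_tendsto_of_antitone {E : Type*} [NormedAddCommGroup E] [NormedSpace ℝ E] [Lattice E]
    [HasSolidNorm E] [IsOrderedAddMonoid E] {ι : Type*} [Preorder ι] [IsDirectedOrder ι]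
    [Nonempty ι] {f : ι → StrongDual ℝ E} (hf : Antitone f) (hf0 : ∀ i, 0 ≤ f i) :
    ∃ g : StrongDual ℝ E, (∀ i, g ≤ f i) ∧
      ∀ x, 0 ≤ x → Tendsto (fun i => f i x) atTop (𝓝 (g x)) := by
  have hbdd : ∀ x, 0 ≤ x → BddBelow (range fun i => f i x) := fun x hx =>
    ⟨0, by rintro _ ⟨i, rfl⟩; exact apply_nonneg (hf0 i) hx⟩
  have hlim : ∀ x, 0 ≤ x → Tendsto (fun i => f i x) atTop (𝓝 (⨅ i, f i x)) := fun x hx =>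
    tendsto_atTop_ciInf (fun i j hij => hf hij x hx) (hbdd x hx)
  have hle : ∀ x, 0 ≤ x → ∀ i, ⨅ i, f i x ≤ f i x := fun x hx i => ciInf_le (hbdd x hx) i
  obtain ⟨i₀⟩ := ‹Nonempty ι›
  obtain ⟨g, hg⟩ := exists_dual_of_additive (s := fun x => ⨅ i, f i x) (C := ‖f i₀‖)
    (fun a b ha hb => tendsto_nhds_unique (hlim _ (add_nonneg ha hb))
      (((hlim a ha).add (hlim b hb)).congr fun i => (map_add _ _ _).symm))
    (fun a ha => by
      rw [abs_of_nonneg (Real.iInf_nonneg fun i => apply_nonneg (hf0 i) ha)]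
      exact (hle a ha i₀).trans (apply_le_norm_mul _ _))
  refine ⟨g, fun i x hx => ?_, fun x hx => ?_⟩
  · rw [hg x hx]
    exact hle x hx i
  · rw [hg x hx]
    exact hlim x hx

variable {E : Type u} [NormedAddCommGroup E] [NormedSpace ℝ E] [Lattice E]
  [IsOrderedAddMonoid E] [HasSolidNorm E]

/-- The remainders `f - ∑ |x k|` decrease to some `g`; order continuity makes the convergence one in
norm, and `|x n|` is at most remainder minus `g`. -/
lemma isLWeaklyCompact_Icc_neg (hE : IsOrderContinuous (StrongDual ℝ E)) {f : StrongDual ℝ E}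
    (hf : 0 ≤ f) : IsLWeaklyCompact (Icc (-f) f) := by
  refine ⟨⟨0, neg_nonpos.2 hf, hf⟩, isBounded_Icc_neg f, fun x hx hd => ?_⟩
  have hxf : ∀ n, |x n| ≤ f := fun n => by
    obtain ⟨g, hg, hxg⟩ := hx n
    exact hxg.trans (abs_le_of_mem_Icc_neg hg)
  set p : ℕ → StrongDual ℝ E := fun n => f - ∑ k ∈ Finset.range n, |x k| with hp
  have hp0 : ∀ n, 0 ≤ p n := fun n => sub_nonneg.2
    (sum_le_of_pairwise_inf (fun k => abs_nonneg _) hf hxf _ hd)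
  have hpx : ∀ n, p n = p (n + 1) + |x n| := fun n => by
    simp only [hp, Finset.sum_range_succ]
    abel
  have hpa : Antitone p := antitone_nat_of_succ_le fun n => by
    rw [hpx n]
    exact le_add_of_nonneg_right (abs_nonneg _)
  obtain ⟨g, hgp, hglim⟩ := exists_tendsto_of_antitone hpa hp0
  have hlim := hE (ULift.{u} ℕ) (fun n => p n.down - g)
    (fun m n hmn => sub_le_sub_right (hpa hmn) g) ⟨?_, fun b hb y hy => ?_⟩
  · have hlim' := hlim.comp (tendsto_atTop.2 fun b =>
      (eventually_ge_atTop b.down).mono fun n hn => hn : Tendsto ULift.up atTop atTop)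
    refine squeeze_zero (fun n => norm_nonneg _) (fun n => ?_) hlim'
    rw [← norm_abs_eq_norm]
    refine norm_le_norm_of_nonneg (abs_nonneg _) ?_
    change |x n| ≤ p n - g
    rw [hpx n, add_sub_right_comm]
    exact le_add_of_nonneg_left (sub_nonneg.2 (hgp _))
  · rintro _ ⟨n, rfl⟩
    exact sub_nonneg.2 (hgp _)
  · have h1 := (hglim y hy).sub_const (g y)
    rw [sub_self] at h1
    exact ge_of_tendsto' h1 fun n => hb ⟨⟨n⟩, rfl⟩ y hy

/-- L-weak compactness of one interval `[-f i₀, f i₀]` gives a `u` off which all later `f i` are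
uniformly small on the unit ball; then convergence at `u` gives norm convergence. -/
lemma isOrderContinuous_dual [CompleteSpace E] [IsOrderedModule ℝ E]
    (H : ∀ f : StrongDual ℝ E, 0 ≤ f → IsLWeaklyCompact (Icc (-f) f)) :
    IsOrderContinuous (StrongDual ℝ E) := by
  intro ι _ _ _ f hf hglb
  have hf0 : ∀ i, 0 ≤ f i := fun i => hglb.1 ⟨i, rfl⟩
  obtain ⟨g, hgf, hglim⟩ := exists_tendsto_of_antitone hf hf0
  have hg0 : g ≤ 0 := hglb.2 (by rintro _ ⟨i, rfl⟩; exact hgf i)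
  obtain ⟨i₀⟩ := ‹Nonempty ι›
  have hLW := H (f i₀) (hf0 i₀)
  refine tendsto_order.2 ⟨fun a ha => Eventually.of_forall fun n => ha.trans_le (norm_nonneg _),
    fun ε hε => ?_⟩
  obtain ⟨R, hR⟩ := hLW.2.1.exists_norm_le
  obtain ⟨u, hu, hu1⟩ := exists_forall_abs_apply_posPart_sub_le hR
    (B := {x : E | 0 ≤ x ∧ ‖x‖ ≤ 1}) (fun x hx => hx.1)
    (fun x hx y hy hyx => ⟨hy, (norm_le_norm_of_nonneg hy hyx).trans hx.2⟩) (fun x hx => hx.2)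
    (fun z h hz hd hh => (hLW.tendsto_abs_apply_abs hd ⟨1, fun n => (hz n).2⟩ hh).congr
      fun n => by rw [abs_of_nonneg (hz n).1]) (half_pos hε)
  filter_upwards [(hglim u hu).eventually_lt_const ((hg0 u hu).trans_lt (half_pos hε)),
    eventually_ge_atTop i₀] with i hi hii
  have := norm_le_add_apply (hf0 i) hu (half_pos hε).le fun x hx hx1 => by
    have h1 := hu1 x ⟨hx, hx1⟩ (f i₀) ⟨neg_le_self (hf0 i₀), le_rfl⟩
    rw [abs_of_nonneg (hf0 i₀)] at h1
    exact (hf hii _ (posPart_nonneg _)).trans h1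
  linarith

end OrderContinuity

/-! ### Operators -/

section Operators

lemma isBounded_adjointMap_image {X Y : Type*} [NormedAddCommGroup X] [NormedSpace ℝ X]
    [NormedAddCommGroup Y] [NormedSpace ℝ Y] (T : X →L[ℝ] Y) {A : Set (StrongDual ℝ Y)}
    (hA : Bornology.IsBounded A) : Bornology.IsBounded (adjointMap T '' A) := by
  obtain ⟨R, hR⟩ := hA.exists_norm_le
  refine isBounded_iff_forall_norm_le.2 ⟨R * ‖T‖, ?_⟩
  rintro _ ⟨f, hf, rfl⟩
  exact (f.opNorm_comp_le T).trans (mul_le_mul_of_nonneg_right (hR f hf) (norm_nonneg T))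

lemma isAlmostLSet_adjointMap_image {F X : Type*} [NormedAddCommGroup F] [NormedSpace ℝ F]
    [Lattice F] [NormedAddCommGroup X] [NormedSpace ℝ X] {S : F →L[ℝ] X}
    (hS : IsAlmostDunfordPettis S) : IsAlmostLSet (adjointMap S '' {φ | ‖φ‖ ≤ 1}) := by
  refine ⟨isBounded_adjointMap_image S (isBounded_iff_forall_norm_le.2 ⟨1, fun _ h => h⟩),
    fun x hd hx => ?_⟩
  refine squeeze_zero (fun n => Real.iSup_nonneg fun _ => abs_nonneg _)
    (fun n => Real.iSup_le ?_ (norm_nonneg _)) (hS x hd hx)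
  rintro ⟨_, φ, hφ, rfl⟩
  refine (φ.le_opNorm (S (x n))).trans ?_
  exact mul_le_of_le_one_left (norm_nonneg _) hφ

open scoped BoundedContinuousFunction in
/-- The operator `y ↦ (f n y)` into a copy of `ℓ^∞` defined by a bounded sequence of
functionals. -/
lemma exists_operator_of_bounded_seq {F : Type*} [NormedAddCommGroup F] [NormedSpace ℝ F]
    {f : ℕ → StrongDual ℝ F} {R : ℝ} (hf : ∀ n, ‖f n‖ ≤ R) :
    ∃ S : F →L[ℝ] ULift.{w} (ℕ →ᵇ ℝ), (∀ n y, |f n y| ≤ ‖S y‖) ∧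
      ∀ y c, 0 ≤ c → (∀ n, |f n y| ≤ c) → ‖S y‖ ≤ c := by
  have hfy : ∀ y n, ‖f n y‖ ≤ R * ‖y‖ := fun y n =>
    ((f n).le_opNorm y).trans (mul_le_mul_of_nonneg_right (hf n) (norm_nonneg y))
  let L : F →ₗ[ℝ] ULift.{w} (ℕ →ᵇ ℝ) :=
    { toFun := fun y => ⟨BoundedContinuousFunction.ofNormedAddCommGroupDiscrete
        (fun n => f n y) (R * ‖y‖) (hfy y)⟩
      map_add' := fun y z => by
        apply ULift.down_injective
        ext n
        exact map_add (f n) y z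
      map_smul' := fun c y => by
        apply ULift.down_injective
        ext n
        exact map_smul (f n) c y }
  have hL : ∀ y c, 0 ≤ c → (∀ n, |f n y| ≤ c) → ‖L y‖ ≤ c := fun y c hc h =>
    (BoundedContinuousFunction.norm_le hc).2 h
  refine ⟨L.mkContinuous R fun y => hL y _ ((norm_nonneg _).trans (hfy y 0)) (hfy y),
    fun n y => ?_, hL⟩
  exact BoundedContinuousFunction.norm_coe_le_norm (L y).down n

variable {E : Type u} [NormedAddCommGroup E] [NormedSpace ℝ E] [CompleteSpace E] [Lattice E]
  [IsOrderedAddMonoid E] [IsOrderedModule ℝ E] [HasSolidNorm E]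
  {F : Type v} [NormedAddCommGroup F] [NormedSpace ℝ F] [CompleteSpace F] [Lattice F]
  [IsOrderedAddMonoid F] [IsOrderedModule ℝ F] [HasSolidNorm F]

theorem tfae_operator (T : E →L[ℝ] F) :
    List.TFAE [
      ∀ f : StrongDual ℝ F, 0 ≤ f → IsLWeaklyCompact (adjointMap T '' Icc (-f) f),
      ∀ x : ℕ → E, NormBoundedSeq x → UawNull x → WeaklyNull fun n => |T (x n)|,
      ∀ f : ℕ → StrongDual ℝ F, OrderBoundedSeq f →
        ∀ x : ℕ → E, NormBoundedSeq x → UawNull x →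
          Tendsto (fun n => f n (T (x n))) atTop (𝓝 0),
      ∀ A : Set (StrongDual ℝ F), A.Nonempty → IsAlmostLSet A →
        IsLWeaklyCompact (adjointMap T '' A),
      ∀ (X : Type w) [NormedAddCommGroup X] [NormedSpace ℝ X] [CompleteSpace X]
        (S : F →L[ℝ] X), IsAlmostDunfordPettis S → IsMWeaklyCompact (S.comp T)] := by
  tfae_have 1 → 3 := by
    rintro h1 f ⟨a, b, hab⟩ x hb hx
    have hf : ∀ n, f n ∈ Icc (-(|a| + |b|)) (|a| + |b|) := fun n =>
      ⟨by
        rw [neg_le]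
        exact (neg_le_neg (hab n).1).trans ((neg_le_abs a).trans
          (le_add_of_nonneg_right (abs_nonneg b))),
      (hab n).2.trans ((le_abs_self b).trans (le_add_of_nonneg_left (abs_nonneg a)))⟩
    exact squeeze_zero_norm (fun n => DualLattice.abs_apply_le (adjointMap T (f n)) (x n))
      ((h1 _ (add_nonneg (abs_nonneg a) (abs_nonneg b))).tendsto_of_uawNull hb hx
        fun n => mem_image_of_mem _ (hf n))
  tfae_have 3 → 2 := by
    intro h3 x hb hx
    refine weaklyNull_of_nonneg fun f hf => ?_
    -- A functional in `[-f, f]` chosen for each `n` absorbs the absolute value.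
    choose g hg hgx using fun n => exists_apply_eq_apply_abs hf (T (x n))
    exact (h3 g ⟨-f, f, hg⟩ x hb hx).congr hgx
  tfae_have 2 → 4 := by
    intro h2 A hne hA
    refine isLWeaklyCompact_of_forall_tendsto (hne.image _) (isBounded_adjointMap_image T hA.1)
      fun x h hd hb hh => ?_
    choose f hfA hfh using hh
    have hTb : NormBoundedSeq fun n => |T (x n)| := by
      obtain ⟨C, hC⟩ := hb
      refine ⟨‖T‖ * C, fun n => ?_⟩
      rw [norm_abs_eq_norm]
      exact (T.le_opNorm _).trans (mul_le_mul_of_nonneg_left (hC n) (norm_nonneg _))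
    refine squeeze_zero_norm (fun n => ?_)
      (hA.tendsto_of_weaklyNull hTb (h2 x hb (uawNull_of_disjoint hd)) (fun n => abs_nonneg _) hfA)
    rw [← hfh n]
    exact DualLattice.abs_apply_le (f n) (T (x n))
  tfae_have 4 → 1 := fun h4 f hf => h4 _ ⟨0, neg_nonpos.2 hf, hf⟩ (isAlmostLSet_Icc_neg f)
  tfae_have 4 → 5 := by
    intro h4 X _ _ _ S hS x hd hb
    have hL := h4 _ (Nonempty.image _ ⟨0, by simp⟩)
      (isAlmostLSet_adjointMap_image hS)
    choose φ hφ hφx using fun n => exists_dual_vector'' ℝ (S (T (x n)))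
    refine squeeze_zero (fun n => norm_nonneg _) (fun n => ?_)
      (hL.tendsto_abs_apply_abs hd hb (h := fun n => adjointMap T (adjointMap S (φ n)))
        fun n => mem_image_of_mem _ (mem_image_of_mem _ (hφ n)))
    refine le_trans (le_of_eq (hφx n).symm) ((le_abs_self _).trans ?_)
    exact DualLattice.abs_apply_le (adjointMap T (adjointMap S (φ n))) (x n)
  tfae_have 5 → 4 := by
    intro h5 A hne hA
    refine isLWeaklyCompact_of_forall_tendsto (hne.image _) (isBounded_adjointMap_image T hA.1)
      fun x h hd hb hh => ?_
    choose f hfA hfh using hh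
    obtain ⟨R, hR⟩ := hA.1.exists_norm_le
    -- `‖S y‖` is the supremum of `|f n y|`, so `S` inherits the almost (L) property of `A`; the
    -- lift places its target in the universe of `X`.
    obtain ⟨S, hS1, hS2⟩ := exists_operator_of_bounded_seq.{w} fun n => hR _ (hfA n)
    have hS : IsAlmostDunfordPettis S := fun y hyd hy =>
      squeeze_zero (fun n => norm_nonneg _) (fun n => hS2 _ _
        (Real.iSup_nonneg fun _ => abs_nonneg _) fun k =>
          le_ciSup (f := fun g : A => |g.1 (y n)|) ⟨R * ‖y n‖, by
            rintro _ ⟨g, rfl⟩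
            exact (g.1.le_opNorm _).trans
              (mul_le_mul_of_nonneg_right (hR _ g.2) (norm_nonneg _))⟩ ⟨f k, hfA k⟩) (hA.2 y hyd hy)
    refine squeeze_zero_norm (fun n => ?_) (h5 _ S hS x hd hb)
    rw [← hfh n]
    exact hS1 n (T (x n))
  tfae_finish

end Operators

end BanachLattice

end

theorem mainTheorem5
    {E : Type u} [NormedAddCommGroup E] [NormedSpace ℝ E] [CompleteSpace E] [Lattice E]
    [IsOrderedAddMonoid E] [IsOrderedModule ℝ E] [HasSolidNorm E]
    {F : Type v} [NormedAddCommGroup F] [NormedSpace ℝ F] [CompleteSpace F] [Lattice F]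
    [IsOrderedAddMonoid F] [IsOrderedModule ℝ F] [HasSolidNorm F]
    (T : E →L[ℝ] F) :
    List.TFAE [
      ∀ f : StrongDual ℝ F, 0 ≤ f → IsLWeaklyCompact (adjointMap T '' Icc (-f) f),
      ∀ x : ℕ → E, NormBoundedSeq x → UawNull x → WeaklyNull fun n => |T (x n)|,
      ∀ f : ℕ → StrongDual ℝ F, OrderBoundedSeq f →
        ∀ x : ℕ → E, NormBoundedSeq x → UawNull x →
          Tendsto (fun n => f n (T (x n))) atTop (𝓝 0),
      ∀ A : Set (StrongDual ℝ F), A.Nonempty → IsAlmostLSet A →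
        IsLWeaklyCompact (adjointMap T '' A),
      ∀ (X : Type w) [NormedAddCommGroup X] [NormedSpace ℝ X] [CompleteSpace X]
        (S : F →L[ℝ] X), IsAlmostDunfordPettis S → IsMWeaklyCompact (S.comp T)] ∧
    List.TFAE [
      IsOrderContinuous (StrongDual ℝ E),
      ∀ x : ℕ → E, NormBoundedSeq x → UawNull x → WeaklyNull fun n => |x n|,
      ∀ f : ℕ → StrongDual ℝ E, OrderBoundedSeq f →
        ∀ x : ℕ → E, NormBoundedSeq x → UawNull x →
          Tendsto (fun n => f n (x n)) atTop (𝓝 0),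
      ∀ A : Set (StrongDual ℝ E), A.Nonempty → IsAlmostLSet A → IsLWeaklyCompact A,
      ∀ (X : Type w) [NormedAddCommGroup X] [NormedSpace ℝ X] [CompleteSpace X]
        (S : E →L[ℝ] X), IsAlmostDunfordPettis S → IsMWeaklyCompact S] := by
  refine ⟨BanachLattice.tfae_operator T, ?_⟩
  have h := BanachLattice.tfae_operator.{u, u, w} (ContinuousLinearMap.id ℝ E)
  have hid : ∀ A : Set (StrongDual ℝ E), adjointMap (ContinuousLinearMap.id ℝ E) '' A = A :=
    fun A => image_id A
  simp only [hid, ContinuousLinearMap.id_apply, ContinuousLinearMap.comp_id] at h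
  have h1 : (∀ f : StrongDual ℝ E, 0 ≤ f → IsLWeaklyCompact (Icc (-f) f)) ↔
      IsOrderContinuous (StrongDual ℝ E) :=
    ⟨BanachLattice.isOrderContinuous_dual, fun hE f hf => BanachLattice.isLWeaklyCompact_Icc_neg hE hf⟩
  rwa [h1] at h
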